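/- Let $\mathbb G$ be a stratified (Carnot) group: a finite-dimensional real linear space $\mathbb G=H^1\oplus\cdots\oplus H^\iota$ with a Lie product such that $[H^1,H^j]=H^{j+1}$ for all $j\ge 1$ ($H^j=\{0\}$ for $j>\iota$, $H^\iota\ne\{0\}$), whose group operation is given by the Baker–Campbell–Hausdorff formula. Fix a scalar product on $\mathbb G$ and an orthonormal basis $(e_1,\dots,e_q)$ adapted to the grading, with $(e_1,\dots,e_m)$ a basis of $H^1$; let $\mu$ (also written $dx$) be the Lebesgue (Haar) measure, $Q=\sum_i i\dim H^i$, $\delta_r$ the dilations ($\delta_r p=r^ip$ for $p\in H^i$), and $X_j g(x)=\frac{d}{dt}\big|_{t=0}g(x\cdot te_j)$, $j=1,\dots,m$, the horizontal left invariant derivatives. Horizontal fields $\phi=\sum_{j\le m}\phi_jX_j$ carry the norm and scalar product $\langle\cdot,\cdot\rangle$ making $X_1,\dots,X_m$ orthonormal, and $\operatorname{div}\phi=\sum_jX_j\phi_j$; for $U$ open, $C_c(HU)$ and $C^1_c(HU)$ are the horizontal fields with continuous, respectively $C^1$, components and compact support in $U$. Let $C^1_H(U)$ be the set of functions $g$ on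 $U$ for which $X_1g,\dots,X_mg$ exist and are continuous in $U$, and put $\nabla_Hg=\sum_{j\le m}(X_jg)X_j$. Let $d$ be a homogeneous distance on $\mathbb G$, that is, a continuous left invariant distance with $d(\delta_rx,\delta_ry)=r\,d(x,y)$ for $r>0$; let $B(0,1)=\{x: d(x,0)<1\}$, $d^{\mathcal R}(x,y)=d(xy^{-1},0)$, and for $\Omega\subset\mathbb G$ open let $\Omega^{\mathcal R}_{\varepsilon}=\{x\in\mathbb G:\inf_{y\in\Omega^c}d^{\mathcal R}(x,y)>\varepsilon\}$ (with $\inf\emptyset=+\infty$). Let $f\in BV_{H,\mathrm{loc}}(\Omega)$, i.e. for every open $U$ with $\overline U$ compact and contained in $\Omega$, $f\in L^1(U)$ and $$|D_Hf|(U):=\sup\Big\{\int_U f\operatorname{div}\phi\,dx:\ \phi\in C^1_c(HU),\ |\phi|\le1\Big\}<\infty,$$ and assume that $|D_Hf|(\Omega)<+\infty$, where $|D_Hf|(\Omega)$ is the same supremum with $U=\Omega$. Let $\rho\in C_c(B(0,1))$ with $\rho\ge0$, $\int\rho\,dx=1$ and $\rho(x)=\rho(x^{-1})$; put $\rho_\varepsilon(x)=\varepsilon^{-Q}\rho(\delta_{1/\varepsilon}x)$,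 $(\rho_\varepsilon*f)(x)=\int_\Omega\rho_\varepsilon(xy^{-1})f(y)\,dy$, and $(\rho_\varepsilon*\nu)(x)=\int_\Omega\rho_\varepsilon(xy^{-1})\,d\nu(y)$ for a (vector) measure $\nu$. Then the distributional horizontal gradient of $f$ is a measure $D_Hf=\sigma_f|D_Hf|$: here $|D_Hf|$ is a Borel measure on $\Omega$ whose value on each open $U\subset\Omega$ is the supremum above, $|\sigma_f|=1$ holds $|D_Hf|$-a.e., and $\int_\Omega f\operatorname{div}\phi\,dx=-\int_\Omega\langle\phi,\sigma_f\rangle\,d|D_Hf|$ for all $\phi\in C^1_c(H\Omega)$. For every $\varepsilon>0$ with $\Omega^{\mathcal R}_{2\varepsilon}\neq\emptyset$ we have $\rho_\varepsilon*f\in C^1_H(\Omega^{\mathcal R}_{2\varepsilon})$, the inequality of measures $$|\nabla_H(\rho_\varepsilon*f)|\,\mu\le(\rho_\varepsilon*|D_Hf|)\,\mu\quad\text{on }\Omega^{\mathcal R}_{2\varepsilon},$$ and $$\int_{\Omega^{\mathcal R}_{2\varepsilon}}|\nabla_H(\rho_\varepsilon*f)|\,dx\le|D_Hf|(\Omega).$$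 Moreover, as $\varepsilon\to0^+$, $\nabla_H(\rho_\varepsilon*f)\rightharpoonup D_Hf$ and $|\rho_\varepsilon*D_Hf|\rightharpoonup|D_Hf|$ locally weakly$^*$ in $\Omega$, that is, $$\int_{\Omega^{\mathcal R}_{2\varepsilon}}\langle\phi,\nabla_H(\rho_\varepsilon*f)\rangle\,dx\to\int_\Omega\langle\phi,\sigma_f\rangle\,d|D_Hf|,\qquad \int_{\Omega^{\mathcal R}_{2\varepsilon}}\psi\,|\rho_\varepsilon*D_Hf|\,dx\to\int_\Omega\psi\,d|D_Hf|$$ for all $\phi\in C_c(H\Omega)$ and all $\psi\in C_c(\Omega)$. -/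

import Mathlib

open MeasureTheory Filter Topology

noncomputable section

namespace CarnotBV

/-- Right-nested iterated bracket `[v₁,[v₂,[…,[vₖ₋₁,vₖ]…]]]` of a word; a one-letter word is
that letter. -/
def nestedBracket {G : Type*} [AddCommGroup G] [Module ℝ G]
    (b : G →ₗ[ℝ] G →ₗ[ℝ] G) : List G → G
  | [] => 0
  | [v] => v
  | v :: w :: l => b v (nestedBracket b (w :: l))

/-- The word `x^{r₁} y^{s₁} ⋯ x^{rₙ} y^{sₙ}`. -/
def bchWord {G : Type*} (x y : G) {n : ℕ} (r s : Fin n → ℕ) : List G :=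
  (List.ofFn fun i => List.replicate (r i) x ++ List.replicate (s i) y).flatten

/-- The Baker-Campbell-Hausdorff series in Dynkin's form,
`∑ₙ (-1)ⁿ⁺¹/n ∑_{rᵢ+sᵢ>0} [x^{r₁}y^{s₁}⋯x^{rₙ}y^{sₙ}] / ((∑ᵢ(rᵢ+sᵢ)) ∏ᵢ rᵢ! sᵢ!)`,
for a bracket that is nilpotent of step at most `N`. A term with `n > N`, or with some
`rᵢ > N` or `sᵢ > N`, is a bracket of more than `N` letters and vanishes, so the finite sum below
is the whole series. -/
def bch {G : Type*} [AddCommGroup G] [Module ℝ G]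
    (b : G →ₗ[ℝ] G →ₗ[ℝ] G) (N : ℕ) (x y : G) : G :=
  ∑ n ∈ Finset.Icc 1 N, ∑ p : Fin n → Fin (N + 1) × Fin (N + 1),
    if ∀ i, 0 < ((p i).1 : ℕ) + ((p i).2 : ℕ) then
      (((-1 : ℝ) ^ (n + 1) / (n : ℝ)) *
        ((∑ i, (((p i).1 : ℝ) + ((p i).2 : ℝ))) *
          ∏ i, ((Nat.factorial (p i).1 : ℝ) * (Nat.factorial (p i).2 : ℝ)))⁻¹) •
        nestedBracket b (bchWord x y (fun i => ((p i).1 : ℕ)) (fun i => ((p i).2 : ℕ)))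
    else 0

/-- A stratified (Carnot) group, identified with its Lie algebra through the exponential map:
a linear space `G` with a Lie bracket, a graded basis `e₁, …, e_q` (orthonormal for the fixed
scalar product of `G`) with degrees `d₁, …, d_q` such that the layers
`Hⁱ = span {eⱼ : dⱼ = i}` satisfy `[H¹, Hⁱ] = Hⁱ⁺¹`, and the group operation given by the
Baker-Campbell-Hausdorff formula. -/
structure StratifiedGroup (G : Type*) [NormedAddCommGroup G] [InnerProductSpace ℝ G]
    [Group G] where
  /-- The Lie product on `G`. -/
  bracket : G →ₗ[ℝ] G →ₗ[ℝ] G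
  bracket_self : ∀ x, bracket x x = 0
  jacobi : ∀ x y z,
    bracket x (bracket y z) + bracket y (bracket z x) + bracket z (bracket x y) = 0
  /-- The topological dimension. -/
  q : ℕ
  /-- The graded basis. -/
  e : OrthonormalBasis (Fin q) ℝ G
  /-- The degree of a basis vector. -/
  deg : Fin q → ℕ
  /-- The step of nilpotence. -/
  step : ℕ
  one_le_deg : ∀ j, 1 ≤ deg j
  deg_le_step : ∀ j, deg j ≤ step
  exists_deg_eq_step : ∃ j, deg j = step
  bracket_layer : ∀ i, 1 ≤ i →
    Submodule.map₂ bracket (Submodule.span ℝ (e '' {j | deg j = 1}))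
      (Submodule.span ℝ (e '' {j | deg j = i})) =
        Submodule.span ℝ (e '' {j | deg j = i + 1})
  mul_eq : ∀ x y : G, x * y = bch bracket step x y

namespace StratifiedGroup

variable {G : Type*} [NormedAddCommGroup G] [InnerProductSpace ℝ G] [Group G]

/-- The intrinsic dilation `δ_r (∑ xⱼ eⱼ) = ∑ r^{dⱼ} xⱼ eⱼ`. -/
def dilation (S : StratifiedGroup G) (r : ℝ) (x : G) : G :=
  ∑ j, (r ^ S.deg j * inner ℝ (S.e j) x) • S.e j

/-- The Hausdorff dimension `Q = ∑ᵢ i dim Hⁱ = ∑ⱼ dⱼ`. -/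
def homDim (S : StratifiedGroup G) : ℕ := ∑ j, S.deg j

/-- Indices of the horizontal (degree one) basis vectors. -/
abbrev HorIdx (S : StratifiedGroup G) : Type := {j : Fin S.q // S.deg j = 1}

/-- The horizontal fibre: a horizontal vector `∑ⱼ vⱼ Xⱼ(p)` at any point `p` is written through
its components in the left invariant orthonormal frame `X₁, …, X_m`, so that the norm is the
left invariant one, and a horizontal vector field is a map `G → S.Hor`. -/
abbrev Hor (S : StratifiedGroup G) : Type := EuclideanSpace ℝ S.HorIdx

/-- A homogeneous distance: a continuous left invariant distance that is one-homogeneous with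
respect to the intrinsic dilations. -/
structure IsHomogeneousDist (S : StratifiedGroup G) (d : G → G → ℝ) : Prop where
  continuous : Continuous fun p : G × G => d p.1 p.2
  eq_zero_iff : ∀ x y, d x y = 0 ↔ x = y
  symm : ∀ x y, d x y = d y x
  triangle : ∀ x y z, d x z ≤ d x y + d y z
  left_invariant : ∀ z x y, d (z * x) (z * y) = d x y
  homogeneous : ∀ r x y, 0 < r → d (S.dilation r x) (S.dilation r y) = r * d x y

/-- The left invariant derivative `X_j g (x) = d/dt g(x · (t e_j))` at `t = 0`. -/
def leftDeriv (S : StratifiedGroup G) (j : S.HorIdx) (g : G → ℝ) (x : G) : ℝ :=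
  deriv (fun t : ℝ => g (x * (t • S.e j.1))) 0

/-- `g ∈ C¹_H(U)`: the pointwise derivatives `X₁g, …, X_m g` exist and are continuous in `U`. -/
def IsC1H (S : StratifiedGroup G) (U : Set G) (g : G → ℝ) : Prop :=
  ∀ j : S.HorIdx,
    (∀ x ∈ U, DifferentiableAt ℝ (fun t : ℝ => g (x * (t • S.e j.1))) 0) ∧
      ContinuousOn (S.leftDeriv j g) U

/-- The horizontal gradient `∇_H g = ∑ⱼ (X_j g) X_j`. -/
def horGrad (S : StratifiedGroup G) (g : G → ℝ) (x : G) : S.Hor :=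
  WithLp.toLp 2 fun j => S.leftDeriv j g x

/-- The divergence `∑ⱼ X_j φ_j` of the horizontal field `φ = ∑ⱼ φ_j X_j`. -/
def horDiv (S : StratifiedGroup G) (φ : G → S.Hor) (x : G) : ℝ :=
  ∑ j, S.leftDeriv j (fun y => φ y j) x

/-- `φ ∈ C¹_c(HU)`. -/
def IsTestField (S : StratifiedGroup G) (U : Set G) (φ : G → S.Hor) : Prop :=
  ContDiff ℝ 1 φ ∧ HasCompactSupport φ ∧ tsupport φ ⊆ U

/-- The right inner part `{x : dist^R(x, Ωᶜ) > ε}`, where `d^R(x,y) = d(xy⁻¹,0)`; the distance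
from the empty set is `+∞`. -/
def rightInner (d : G → G → ℝ) (Ω : Set G) (ε : ℝ) : Set G :=
  {x | ENNReal.ofReal ε < ⨅ y ∈ Ωᶜ, ENNReal.ofReal (d (x * y⁻¹) 0)}

/-- `ρ_ε(x) = ε^{-Q} ρ(δ_{1/ε} x)`. -/
def rescale (S : StratifiedGroup G) (ρ : G → ℝ) (ε : ℝ) (x : G) : ℝ :=
  (ε ^ S.homDim)⁻¹ * ρ (S.dilation (1 / ε) x)

/-- `ρ ∈ C_c(B(0,1))` (extended by zero), `ρ ≥ 0`, `∫ ρ = 1` and `ρ(x) = ρ(x⁻¹)`. -/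
structure IsSymmMollifier [FiniteDimensional ℝ G] [MeasurableSpace G] [BorelSpace G]
    (d : G → G → ℝ) (ρ : G → ℝ) : Prop where
  continuous : Continuous ρ
  hasCompactSupport : HasCompactSupport ρ
  tsupport_subset : tsupport ρ ⊆ {x | d x 0 < 1}
  nonneg : ∀ x, 0 ≤ ρ x
  integral_eq_one : ∫ x, ρ x = 1
  symm : ∀ x, ρ x⁻¹ = ρ x

/-- The mollification `(ρ_ε * f)(x) = ∫_Ω ρ_ε(xy⁻¹) f(y) dy`. -/
def mollify [FiniteDimensional ℝ G] [MeasurableSpace G] [BorelSpace G]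
    (S : StratifiedGroup G) (ρ : G → ℝ) (ε : ℝ) (Ω : Set G) (f : G → ℝ) (x : G) : ℝ :=
  ∫ y in Ω, S.rescale ρ ε (x * y⁻¹) * f y

/-- The mollification `(ρ_ε * γ)(x) = ∫_Ω ρ_ε(xy⁻¹) dγ(y)` of a nonnegative measure. -/
def mollifyMeasure [MeasurableSpace G]
    (S : StratifiedGroup G) (ρ : G → ℝ) (ε : ℝ) (Ω : Set G) (γ : Measure G) (x : G) : ℝ :=
  ∫ y in Ω, S.rescale ρ ε (x * y⁻¹) ∂γ

/-- The mollification `ρ_ε * (σγ) = ∑ⱼ (ρ_ε * (σʲγ)) Xⱼ` of a vector measure in `HΩ`. -/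
def mollifyVecMeasure [MeasurableSpace G] (S : StratifiedGroup G) (ρ : G → ℝ) (ε : ℝ)
    (Ω : Set G) (γ : Measure G) (σ : G → S.Hor) (x : G) : S.Hor :=
  WithLp.toLp 2 fun j => ∫ y in Ω, S.rescale ρ ε (x * y⁻¹) * σ y j ∂γ

/-- The h-variation `|D_H f|(U) = sup {∫_U f div φ : φ ∈ C¹_c(HU), |φ| ≤ 1}`. -/
def hVariation [FiniteDimensional ℝ G] [MeasurableSpace G] [BorelSpace G]
    (S : StratifiedGroup G) (f : G → ℝ) (U : Set G) : ENNReal :=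
  ⨆ (φ : G → S.Hor) (_ : S.IsTestField U φ ∧ ∀ x, ‖φ x‖ ≤ 1),
    ENNReal.ofReal (∫ x in U, f x * S.horDiv φ x)

/-- `f ∈ BV_H(U)`. -/
def IsBVH [FiniteDimensional ℝ G] [MeasurableSpace G] [BorelSpace G]
    (S : StratifiedGroup G) (U : Set G) (f : G → ℝ) : Prop :=
  IntegrableOn f U ∧ S.hVariation f U < ⊤

/-- `f ∈ BV_{H,loc}(Ω)`. -/
def IsBVHLoc [FiniteDimensional ℝ G] [MeasurableSpace G] [BorelSpace G]
    (S : StratifiedGroup G) (Ω : Set G) (f : G → ℝ) : Prop :=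
  ∀ U : Set G, IsOpen U → IsCompact (closure U) → closure U ⊆ Ω → S.IsBVH U f

/-- `D_H f = σ γ` is the polar decomposition of the distributional horizontal gradient of `f` in
`Ω`: `γ = |D_H f|` is the variation measure (a Borel measure concentrated on `Ω` that gives every
open `U ⊆ Ω` the h-variation of `f` in `U`), `|σ| = 1` holds `γ`-a.e., and `f` is integrated by
parts against `σ γ`. -/
structure IsHorGradMeasure [FiniteDimensional ℝ G] [MeasurableSpace G] [BorelSpace G]
    (S : StratifiedGroup G) (Ω : Set G) (f : G → ℝ) (γ : Measure G) (σ : G → S.Hor) :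
    Prop where
  concentrated : γ Ωᶜ = 0
  apply_open : ∀ U : Set G, IsOpen U → U ⊆ Ω → γ U = S.hVariation f U
  aestronglyMeasurable : AEStronglyMeasurable σ γ
  norm_eq_one : ∀ᵐ x ∂γ, ‖σ x‖ = 1
  integral_by_parts : ∀ φ : G → S.Hor, S.IsTestField Ω φ →
    ∫ x in Ω, f x * S.horDiv φ x = -∫ x in Ω, inner ℝ (φ x) (σ x) ∂γ

end StratifiedGroup

end CarnotBV

end

noncomputable section

namespace CarnotBV

/-! ### Nested brackets and the Baker-Campbell-Hausdorff product -/

section Bracket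

variable {G : Type*} [AddCommGroup G] [Module ℝ G] (b : G →ₗ[ℝ] G →ₗ[ℝ] G)

/-! Existence of `D_H f`. The h-variation is superadditive on disjoint open sets, because fields
with disjoint supports may be added, and subadditive on open sets, by a partition of unity. Its
infimum over neighbourhoods is therefore a content on compact sets, and the induced Borel measure γ
returns the h-variation on open subsets of Ω (`exists_variation_measure`). Slicing a test field φ by
its superlevel sets gives |∫ f div φ| ≤ ∫ |φ| dγ (`abs_divPairing_le`). As γ is finite, the pairing
is bounded in L²(γ), so Hahn-Banach and Riesz represent it by some v in L²(γ). The L² bound gives ∫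
|v|² ≤ γ(G), the definition of the variation gives γ(G) ≤ ∫ |v|, and together they force |v| = 1
almost everywhere; σ is −v.

Gradient of the mollification. Since (x · te_j)y⁻¹ = x(y · (−t)e_j)⁻¹, differentiating k(xy⁻¹) along
X_j in x is minus differentiating it along X_j in y. For a C¹ kernel, integration by parts in y then
gives X_j(k * f) = k * (σ_j γ). The kernel ρ is only continuous, but uniform approximation by C¹
kernels makes the derivatives converge uniformly, γ being finite (`hasDerivAt_of_continuous`). Hence
∇_H(ρ_ε * f) = ρ_ε * D_H f on the right inner part. The pointwise bound is the triangle inequality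
for integrals, and the mass bound is Tonelli together with the right invariance of Lebesgue measure,
which holds because right translations are unipotent for the grading (`det_fderiv_mul_right`).

Weak convergence. Fubini moves the mollifier onto the test function, which changes little under
small left multiplications (`tendsto_integral_mul_mollify`). For the variations, it suffices that
the nonnegative defect ρ_ε * γ − |ρ_ε * (σγ)| tends weakly to zero; it is dominated by an expression
linear in the two mollified measures, built from a continuous L¹(γ) approximation of σ, whose limit
is small. -/

theorem nestedBracket_cons (v : G) {l : List G} (hl : l ≠ []) :
    nestedBracket b (v :: l) = b v (nestedBracket b l) := by
  cases l with
  | nil => exact absurd rfl hl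
  | cons w l => rfl

/-- A nested bracket of at least two letters that are all proportional to one vector vanishes. -/
theorem nestedBracket_eq_zero_of_smul (hb : ∀ x, b x x = 0) (v : G) :
    ∀ l : List G, (∀ w ∈ l, ∃ c : ℝ, w = c • v) → 2 ≤ l.length → nestedBracket b l = 0
  | [], _, h => by simp at h
  | [_], _, h => by simp at h
  | [x, y], h, _ => by
    obtain ⟨s, rfl⟩ := h x (by simp)
    obtain ⟨t, rfl⟩ := h y (by simp)
    simp [nestedBracket, hb]
  | x :: y :: z :: l, h, _ => by
    rw [nestedBracket_cons b x (by simp), nestedBracket_eq_zero_of_smul hb v (y :: z :: l)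
      (fun w hw => h w (by simp [hw])) (by simp), map_zero]

/-- If bracketing maps `A` into `B ≤ A`, then nested brackets of two words that agree letterwise
modulo `A` agree modulo `A`, and even modulo `B` as soon as they have two letters. -/
theorem nestedBracket_sub_mem {A B : Submodule ℝ G} (hBA : B ≤ A)
    (hl : ∀ x, ∀ a ∈ A, b x a ∈ B) (hr : ∀ x, ∀ a ∈ A, b a x ∈ B) :
    ∀ l l' : List G, List.Forall₂ (fun v w => v - w ∈ A) l l' →
      nestedBracket b l - nestedBracket b l' ∈ A ∧
        (2 ≤ l.length → nestedBracket b l - nestedBracket b l' ∈ B) := by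
  intro l l' h
  induction h with
  | nil => simp [nestedBracket]
  | @cons v w l l' hvw hll ih =>
    by_cases hl0 : l = []
    · subst hl0
      cases hll
      simpa [nestedBracket] using hvw
    · have hl0' : l' ≠ [] := by
        rintro rfl
        cases hll
        exact hl0 rfl
      have key : nestedBracket b (v :: l) - nestedBracket b (w :: l') ∈ B := by
        rw [nestedBracket_cons b v hl0, nestedBracket_cons b w hl0']
        have : b v (nestedBracket b l) - b w (nestedBracket b l') =
            b v (nestedBracket b l - nestedBracket b l') + b (v - w) (nestedBracket b l') := by
          simp
        rw [this]
        exact B.add_mem (hl _ _ ih.1) (hr _ _ hvw)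
      exact ⟨hBA key, fun _ => key⟩

theorem length_bchWord {H : Type*} (x y : H) {n : ℕ} (r s : Fin n → ℕ) :
    (bchWord x y r s).length = ∑ i, (r i + s i) := by
  simp [bchWord, List.length_flatten, List.map_ofFn, List.sum_ofFn, Function.comp_def]

theorem mem_bchWord {H : Type*} {x y w : H} {n : ℕ} {r s : Fin n → ℕ}
    (h : w ∈ bchWord x y r s) : w = x ∨ w = y := by
  simp only [bchWord, List.mem_flatten, List.mem_ofFn] at h
  obtain ⟨l, ⟨i, rfl⟩, hw⟩ := h
  rcases List.mem_append.1 hw with h | h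
  · exact Or.inl (List.eq_of_mem_replicate h)
  · exact Or.inr (List.eq_of_mem_replicate h)

theorem forall₂_bchWord {H : Type*} {R : H → H → Prop} {x x' y y' : H} (hx : R x x') (hy : R y y')
    {n : ℕ} (r s : Fin n → ℕ) : List.Forall₂ R (bchWord x y r s) (bchWord x' y' r s) := by
  have hrep : ∀ (k : ℕ) {a a' : H}, R a a' →
      List.Forall₂ R (List.replicate k a) (List.replicate k a') := by
    intro k a a' h
    induction k with
    | zero => simp
    | succ k ih => simpa [List.replicate_succ] using ⟨h, ih⟩
  have happ : ∀ {l₁ l₁' l₂ l₂' : List H}, List.Forall₂ R l₁ l₁' → List.Forall₂ R l₂ l₂' →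
      List.Forall₂ R (l₁ ++ l₂) (l₁' ++ l₂') := by
    intro l₁ l₁' l₂ l₂' h₁ h₂
    induction h₁ with
    | nil => simpa using h₂
    | cons h _ ih => simpa using ⟨h, ih⟩
  induction n with
  | zero => simp [bchWord]
  | succ n ih =>
    simp only [bchWord, List.ofFn_succ, List.flatten_cons]
    exact happ (happ (hrep _ hx) (hrep _ hy)) (ih (fun i => r i.succ) (fun i => s i.succ))

/-- The part of the Baker-Campbell-Hausdorff series that consists of proper brackets. -/
def bchHigher (N : ℕ) (x y : G) : G :=
  ∑ n ∈ Finset.Icc 1 N, ∑ p : Fin n → Fin (N + 1) × Fin (N + 1),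
    if (∀ i, 0 < ((p i).1 : ℕ) + ((p i).2 : ℕ)) ∧ 2 ≤ ∑ i, (((p i).1 : ℕ) + ((p i).2 : ℕ)) then
      (((-1 : ℝ) ^ (n + 1) / (n : ℝ)) *
        ((∑ i, (((p i).1 : ℝ) + ((p i).2 : ℝ))) *
          ∏ i, ((Nat.factorial (p i).1 : ℝ) * (Nat.factorial (p i).2 : ℝ)))⁻¹) •
        nestedBracket b (bchWord x y (fun i => ((p i).1 : ℕ)) (fun i => ((p i).2 : ℕ)))
    else 0

/-- Every block contributes a letter, so one-letter words occur only for `n = 1`, with exponents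
(1,0) or (0,1), and there the coefficient is 1. All other terms are common to both sums. -/
theorem bch_eq_add_bchHigher {N : ℕ} (hN : 1 ≤ N) (x y : G) :
    bch b N x y = x + y + bchHigher b N x y := by
  rw [← sub_eq_iff_eq_add, bch, bchHigher, ← Finset.sum_sub_distrib]
  rw [Finset.sum_eq_single_of_mem 1 (by simp [hN])]
  · rw [← Finset.sum_sub_distrib,
      ← (Equiv.funUnique (Fin 1) (Fin (N + 1) × Fin (N + 1))).symm.sum_comp,
      ← Finset.sum_subset (Finset.subset_univ
        {((⟨1, by omega⟩ : Fin (N + 1)), (0 : Fin (N + 1))), (0, ⟨1, by omega⟩)})]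
    · rw [Finset.sum_pair (by simp [Prod.ext_iff, Fin.ext_iff])]
      simp [bchWord, nestedBracket]
    · rintro ⟨⟨r, hr⟩, ⟨s, hs⟩⟩ - h
      simp only [Finset.mem_insert, Finset.mem_singleton, Prod.mk.injEq, Fin.ext_iff, not_or,
        Fin.val_zero, not_and] at h
      have h1 : (0 < r + s) ↔ (0 < r + s ∧ 2 ≤ r + s) := by omega
      simp only [Equiv.funUnique_symm_apply, uniqueElim_const, Finset.univ_unique,
        Finset.sum_singleton, forall_const]
      rw [sub_eq_zero]
      exact if_congr h1 rfl rfl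
  · intro n hn hn1
    rw [← Finset.sum_sub_distrib]
    refine Finset.sum_eq_zero fun p _ => ?_
    rw [sub_eq_zero]
    refine if_congr ⟨fun h => ⟨h, ?_⟩, fun h => h.1⟩ rfl rfl
    have : ∑ _i : Fin n, 1 ≤ ∑ i, (((p i).1 : ℕ) + ((p i).2 : ℕ)) :=
      Finset.sum_le_sum fun i _ => h i
    simp at this hn
    omega

/-- Proper brackets of multiples of one vector vanish, which leaves the linear part. Lines through 0
are thus one-parameter subgroups; the unit 0 and the inverse −x come from here. -/
theorem bch_smul_smul (hb : ∀ x, b x x = 0) {N : ℕ} (hN : 1 ≤ N) (s t : ℝ) (v : G) :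
    bch b N (s • v) (t • v) = (s + t) • v := by
  rw [bch_eq_add_bchHigher b hN, bchHigher, add_smul, add_eq_left]
  refine Finset.sum_eq_zero fun n _ => Finset.sum_eq_zero fun p _ => ?_
  split_ifs with h
  · rw [nestedBracket_eq_zero_of_smul b hb v, smul_zero]
    · intro w hw
      rcases mem_bchWord hw with rfl | rfl
      exacts [⟨s, rfl⟩, ⟨t, rfl⟩]
    · rw [length_bchWord]
      exact h.2
  · rfl

/-- The linear part of the series accounts for `h` exactly; the rest consists of brackets of at
least two letters, which change only by elements of `B`. -/
theorem bch_add_left_sub_mem {A B : Submodule ℝ G} (hBA : B ≤ A)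
    (hl : ∀ x, ∀ a ∈ A, b x a ∈ B) (hr : ∀ x, ∀ a ∈ A, b a x ∈ B) {N : ℕ} (hN : 1 ≤ N)
    (x y : G) {h : G} (hh : h ∈ A) : bch b N (x + h) y - bch b N x y - h ∈ B := by
  have : bch b N (x + h) y - bch b N x y - h = bchHigher b N (x + h) y - bchHigher b N x y := by
    rw [bch_eq_add_bchHigher b hN, bch_eq_add_bchHigher b hN]
    abel
  rw [this, bchHigher, bchHigher, ← Finset.sum_sub_distrib]
  refine B.sum_mem fun n _ => ?_
  rw [← Finset.sum_sub_distrib]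
  refine B.sum_mem fun p _ => ?_
  split_ifs with hp
  · rw [← smul_sub]
    refine B.smul_mem _ ((nestedBracket_sub_mem b hBA hl hr _ _
      (forall₂_bchWord ?_ ?_ _ _)).2 ?_)
    · simpa using hh
    · simp
    · rw [length_bchWord]
      exact hp.2
  · simp

end Bracket

/-- The letters are functions so that the induction on the word applies to words in the two
projections of `G × G`. -/
theorem contDiff_nestedBracket {G : Type*} [NormedAddCommGroup G] [NormedSpace ℝ G]
    [FiniteDimensional ℝ G] (b : G →ₗ[ℝ] G →ₗ[ℝ] G) {E : Type*} [NormedAddCommGroup E]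
    [NormedSpace ℝ E] {n : WithTop ℕ∞} :
    ∀ l : List (E → G), (∀ u ∈ l, ContDiff ℝ n u) →
      ContDiff ℝ n fun p => nestedBracket b (l.map fun u => u p)
  | [], _ => contDiff_const
  | [u], h => h u (by simp)
  | u :: v :: l, h => by
    have ih := contDiff_nestedBracket b (n := n) (v :: l) fun w hw => h w (by simp [hw])
    have hu : ContDiff ℝ n u := h u (by simp)
    let B : G →L[ℝ] G →L[ℝ] G :=
      LinearMap.toContinuousLinearMap (LinearMap.toContinuousLinearMap.toLinearMap ∘ₗ b)
    exact (B.contDiff.comp hu).clm_apply ih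

theorem bchWord_map {H K : Type*} (g : H → K) (x y : H) {n : ℕ} (r s : Fin n → ℕ) :
    (bchWord x y r s).map g = bchWord (g x) (g y) r s := by
  simp [bchWord, List.map_flatten, List.map_ofFn, Function.comp_def]

theorem contDiff_bch {G : Type*} [NormedAddCommGroup G] [NormedSpace ℝ G]
    [FiniteDimensional ℝ G] (b : G →ₗ[ℝ] G →ₗ[ℝ] G) (N : ℕ) {n : WithTop ℕ∞} :
    ContDiff ℝ n fun p : G × G => bch b N p.1 p.2 := by
  refine ContDiff.sum fun k _ => ContDiff.sum fun p _ => ?_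
  split_ifs with h
  · refine contDiff_const.smul ?_
    have := contDiff_nestedBracket b (n := n) (bchWord (Prod.fst : G × G → G) Prod.snd
      (fun i => ((p i).1 : ℕ)) (fun i => ((p i).2 : ℕ))) (by
        intro u hu
        rcases mem_bchWord hu with rfl | rfl
        exacts [contDiff_fst, contDiff_snd])
    simpa only [bchWord_map] using this
  · exact contDiff_const

namespace StratifiedGroup

/-! ### The group law, the layers and the degree filtration -/

section Algebra

variable {G : Type*} [NormedAddCommGroup G] [InnerProductSpace ℝ G] [Group G]
  (S : StratifiedGroup G)

theorem one_le_step : 1 ≤ S.step := by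
  obtain ⟨j, hj⟩ := S.exists_deg_eq_step
  exact hj ▸ S.one_le_deg j

theorem smul_mul_smul (S : StratifiedGroup G) (s t : ℝ) (v : G) :
    (s • v) * (t • v) = (s + t) • v := by
  rw [S.mul_eq, bch_smul_smul _ S.bracket_self S.one_le_step]

theorem one_eq_zero (S : StratifiedGroup G) : (1 : G) = 0 := by
  have := S.smul_mul_smul 0 0 (0 : G)
  simp only [smul_zero] at this
  exact (mul_eq_left.1 this).symm

theorem inv_eq_neg (S : StratifiedGroup G) (x : G) : x⁻¹ = -x := by
  rw [inv_eq_iff_mul_eq_one, S.one_eq_zero]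
  simpa using S.smul_mul_smul 1 (-1) x

theorem zero_mul' (S : StratifiedGroup G) (x : G) : 0 * x = x := by rw [← S.one_eq_zero, one_mul]

theorem mul_zero' (S : StratifiedGroup G) (x : G) : x * 0 = x := by rw [← S.one_eq_zero, mul_one]

theorem bracket_skew (x y : G) : S.bracket x y = -S.bracket y x := by
  have h := S.bracket_self (x + y)
  simp only [map_add, LinearMap.add_apply, S.bracket_self, zero_add, add_zero] at h
  exact eq_neg_of_add_eq_zero_right h

/-- The layer `Hⁱ`. -/
def layer (i : ℕ) : Submodule ℝ G := Submodule.span ℝ (S.e '' {j | S.deg j = i})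

theorem bracket_mem_layer_succ {k : ℕ} (hk : 1 ≤ k) {x y : G} (hx : x ∈ S.layer 1)
    (hy : y ∈ S.layer k) : S.bracket x y ∈ S.layer (k + 1) := by
  rw [layer, ← S.bracket_layer k hk]
  exact Submodule.apply_mem_map₂ _ hx hy

/-- Hⁱ⁺¹ is spanned by brackets [a,c] with a in H¹ and c in Hⁱ, and Jacobi gives [[a,c],y] =
[a,[c,y]] − [c,[a,y]]. The second term uses the induction hypothesis with `k + 1`, hence `k` is
quantified inside. -/
theorem bracket_mem_layer {i : ℕ} (hi : 1 ≤ i) : ∀ {k : ℕ}, 1 ≤ k → ∀ {x y : G},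
    x ∈ S.layer i → y ∈ S.layer k → S.bracket x y ∈ S.layer (i + k) := by
  induction i, hi using Nat.le_induction with
  | base =>
    intro k hk x y hx hy
    rw [add_comm]
    exact S.bracket_mem_layer_succ hk hx hy
  | succ i hi ih =>
    intro k hk x y hx hy
    suffices h : S.layer (i + 1) ≤ (S.layer (i + 1 + k)).comap (S.bracket.flip y) from h hx
    rw [layer, ← S.bracket_layer i hi, Submodule.map₂_le]
    intro a ha c hc
    rw [Submodule.mem_comap, LinearMap.flip_apply]
    have hjac : S.bracket (S.bracket a c) y =
        S.bracket a (S.bracket c y) - S.bracket c (S.bracket a y) := by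
      have h := S.jacobi a c y
      rw [S.bracket_skew y a, S.bracket_skew y, map_neg] at h
      linear_combination (norm := abel) -h
    rw [hjac]
    refine Submodule.sub_mem _ ?_ ?_
    · have := S.bracket_mem_layer_succ (by omega) ha (ih hk hc hy)
      rwa [show i + k + 1 = i + 1 + k by omega] at this
    · have := ih (by omega) hc (S.bracket_mem_layer_succ hk ha hy)
      rwa [show i + (k + 1) = i + 1 + k by omega] at this

/-- The span `Hᵏ ⊕ Hᵏ⁺¹ ⊕ ⋯` of the basis vectors of degree at least `k`. -/
def filt (k : ℕ) : Submodule ℝ G := Submodule.span ℝ (S.e '' {j | k ≤ S.deg j})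

theorem filt_anti {k l : ℕ} (h : k ≤ l) : S.filt l ≤ S.filt k :=
  Submodule.span_mono (Set.image_mono fun _ hj => le_trans h hj)

theorem layer_le_filt {k i : ℕ} (h : k ≤ i) : S.layer i ≤ S.filt k := by
  refine Submodule.span_mono (Set.image_mono fun j hj => ?_)
  have : S.deg j = i := hj
  exact h.trans_eq this.symm

/-- By bilinearity this is a statement about basis vectors, and each of them has degree at least
one. -/
theorem bracket_mem_filt {k : ℕ} (x : G) {y : G} (hy : y ∈ S.filt k) :
    S.bracket x y ∈ S.filt (k + 1) := by
  have hx : x ∈ Submodule.span ℝ (Set.range S.e) := by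
    rw [← S.e.coe_toBasis, S.e.toBasis.span_eq]
    trivial
  induction hx using Submodule.span_induction with
  | mem x hx =>
    obtain ⟨i, rfl⟩ := hx
    induction hy using Submodule.span_induction with
    | mem y hy =>
      obtain ⟨j, hj, rfl⟩ := hy
      have hj' : k ≤ S.deg j := hj
      refine S.layer_le_filt (i := S.deg i + S.deg j) ?_
        (S.bracket_mem_layer (S.one_le_deg i) (S.one_le_deg j) ?_ ?_)
      · have := S.one_le_deg i
        omega
      · exact Submodule.subset_span ⟨i, rfl, rfl⟩
      · exact Submodule.subset_span ⟨j, rfl, rfl⟩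
    | zero => simp
    | add u v _ _ hu hv =>
      rw [map_add]
      exact Submodule.add_mem _ hu hv
    | smul c u _ hu =>
      rw [map_smul]
      exact Submodule.smul_mem _ _ hu
  | zero => simp
  | add u v _ _ hu hv =>
    rw [map_add, LinearMap.add_apply]
    exact Submodule.add_mem _ hu hv
  | smul c u _ hu =>
    rw [map_smul, LinearMap.smul_apply]
    exact Submodule.smul_mem _ _ hu

/-- Right translations are triangular for the grading, with the identity on the diagonal. -/
theorem add_mul_sub_mem_filt {k : ℕ} (x y : G) {h : G} (hh : h ∈ S.filt k) :
    (x + h) * y - x * y - h ∈ S.filt (k + 1) := by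
  rw [S.mul_eq, S.mul_eq]
  refine bch_add_left_sub_mem _ (S.filt_anti k.le_succ) (fun x a ha => S.bracket_mem_filt x ha)
    (fun x a ha => ?_) S.one_le_step x y hh
  rw [S.bracket_skew]
  exact Submodule.neg_mem _ (S.bracket_mem_filt x ha)

theorem inner_eq_zero_of_mem_filt {k : ℕ} {j : Fin S.q} (hj : S.deg j < k) {x : G}
    (hx : x ∈ S.filt k) : inner ℝ (S.e j) x = 0 := by
  induction hx using Submodule.span_induction with
  | mem x hx =>
    obtain ⟨i, hi, rfl⟩ := hx
    have hi' : k ≤ S.deg i := hi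
    refine S.e.inner_eq_zero ?_
    rintro rfl
    omega
  | zero => simp
  | add u v _ _ hu hv => rw [inner_add_right, hu, hv, add_zero]
  | smul c u _ hu => rw [inner_smul_right, hu, mul_zero]

theorem contDiff_inv (S : StratifiedGroup G) {n : WithTop ℕ∞} : ContDiff ℝ n fun x : G => x⁻¹ := by
  simp only [S.inv_eq_neg]
  exact contDiff_neg

theorem continuous_inv' (S : StratifiedGroup G) : Continuous fun x : G => x⁻¹ :=
  (S.contDiff_inv (n := 0)).continuous

variable [FiniteDimensional ℝ G]

theorem contDiff_mul (S : StratifiedGroup G) {n : WithTop ℕ∞} :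
    ContDiff ℝ n fun p : G × G => p.1 * p.2 := by
  simp only [S.mul_eq]
  exact contDiff_bch _ _

theorem continuous_mul' (S : StratifiedGroup G) : Continuous fun p : G × G => p.1 * p.2 :=
  (S.contDiff_mul (n := 0)).continuous

end Algebra

/-! ### Dilations and the invariance of Lebesgue measure -/

section Haar

variable {G : Type*} [NormedAddCommGroup G] [InnerProductSpace ℝ G] [Group G]

theorem ext_inner (S : StratifiedGroup G) {x y : G}
    (h : ∀ j, inner ℝ (S.e j) x = inner ℝ (S.e j) y) : x = y := by
  rw [← S.e.sum_repr' x, ← S.e.sum_repr' y]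
  simp only [h]

theorem dilation_zero (S : StratifiedGroup G) (r : ℝ) : S.dilation r 0 = 0 := by
  simp [dilation]

theorem inner_dilation (S : StratifiedGroup G) (r : ℝ) (x : G) (j : Fin S.q) :
    inner ℝ (S.e j) (S.dilation r x) = r ^ S.deg j * inner ℝ (S.e j) x := by
  simp [dilation, inner_sum, inner_smul_right, S.e.inner_eq_ite]

theorem dilation_dilation (S : StratifiedGroup G) (r s : ℝ) (x : G) :
    S.dilation r (S.dilation s x) = S.dilation (r * s) x := by
  refine S.ext_inner fun j => ?_
  simp only [inner_dilation]
  ring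

theorem dilation_one (S : StratifiedGroup G) (x : G) : S.dilation 1 x = x := by
  refine S.ext_inner fun j => ?_
  simp [inner_dilation]

theorem dilation_zero_left (S : StratifiedGroup G) (x : G) : S.dilation 0 x = 0 := by
  refine S.ext_inner fun j => ?_
  simp [inner_dilation, Nat.one_le_iff_ne_zero.1 (S.one_le_deg j)]

theorem continuous_dilation (S : StratifiedGroup G) :
    Continuous fun p : ℝ × G => S.dilation p.1 p.2 := by
  unfold dilation
  fun_prop

/-- The dilation as a linear map. -/
def dilationLin (S : StratifiedGroup G) (r : ℝ) : G →ₗ[ℝ] G where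
  toFun := S.dilation r
  map_add' x y := by simp [dilation, inner_add_right, mul_add, add_smul, Finset.sum_add_distrib]
  map_smul' c x := by
    simp only [dilation, inner_smul_right, RingHom.id_apply, Finset.smul_sum, smul_smul]
    refine Finset.sum_congr rfl fun j _ => ?_
    congr 1
    ring

theorem det_dilationLin (S : StratifiedGroup G) (r : ℝ) :
    LinearMap.det (S.dilationLin r) = r ^ S.homDim := by
  rw [← LinearMap.det_toMatrix S.e.toBasis]
  have : LinearMap.toMatrix S.e.toBasis S.e.toBasis (S.dilationLin r) =
      Matrix.diagonal fun j => r ^ S.deg j := by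
    ext i j
    rw [LinearMap.toMatrix_apply, OrthonormalBasis.coe_toBasis_repr_apply,
      S.e.repr_apply_apply, S.e.coe_toBasis]
    change inner ℝ (S.e i) (S.dilation r (S.e j)) = _
    rw [inner_dilation, S.e.inner_eq_ite, Matrix.diagonal_apply]
    simp
  rw [this, Matrix.det_diagonal, homDim, Finset.prod_pow_eq_pow_sum]

variable [FiniteDimensional ℝ G]

/-- Along t ↦ (x + te_j)y the coordinates of degree at most `deg j` are affine with slope δ_ij, by
`add_mul_sub_mem_filt`. The Jacobian matrix is therefore block triangular with identity blocks. -/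
theorem det_fderiv_mul_right (S : StratifiedGroup G) (x y : G) :
    (fderiv ℝ (fun z : G => z * y) x).det = 1 := by
  set D := fderiv ℝ (fun z : G => z * y) x with hD
  have hdiff : DifferentiableAt ℝ (fun z : G => z * y) x :=
    ((S.contDiff_mul (n := 1)).comp (contDiff_id.prodMk contDiff_const)).differentiable
      one_ne_zero x
  have key : ∀ i j, S.deg i ≤ S.deg j →
      inner ℝ (S.e i) (D (S.e j)) = inner ℝ (S.e i) (S.e j) := by
    intro i j hij
    have hline : HasDerivAt (fun t : ℝ => inner ℝ (S.e i) ((x + t • S.e j) * y))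
        (inner ℝ (S.e i) (D (S.e j))) 0 := by
      have h1 : HasDerivAt (fun t : ℝ => x + t • S.e j) (S.e j) 0 := by
        simpa using ((hasDerivAt_id (0 : ℝ)).smul_const (S.e j)).const_add x
      have h2 : HasFDerivAt (fun z : G => z * y) D (x + (0 : ℝ) • S.e j) := by
        simpa using hdiff.hasFDerivAt
      have h3 := h2.comp_hasDerivAt (0 : ℝ) h1
      exact (innerSL ℝ (S.e i)).hasFDerivAt.comp_hasDerivAt (0 : ℝ) h3
    have hlin : (fun t : ℝ => inner ℝ (S.e i) ((x + t • S.e j) * y)) =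
        fun t : ℝ => inner ℝ (S.e i) (x * y) + t * inner ℝ (S.e i) (S.e j) := by
      funext t
      have hm : t • S.e j ∈ S.filt (S.deg j) :=
        Submodule.smul_mem _ _ (Submodule.subset_span ⟨j, show S.deg j ≤ S.deg j from le_refl _, rfl⟩)
      have := S.inner_eq_zero_of_mem_filt (Nat.lt_succ_of_le hij)
        (S.add_mul_sub_mem_filt x y hm)
      rw [inner_sub_right, inner_sub_right, inner_smul_right] at this
      linarith
    rw [hlin] at hline
    have h3 : HasDerivAt (fun t : ℝ => inner ℝ (S.e i) (x * y) + t * inner ℝ (S.e i) (S.e j))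
        (inner ℝ (S.e i) (S.e j)) 0 := by
      simpa using ((hasDerivAt_id (0 : ℝ)).mul_const (inner ℝ (S.e i) (S.e j))).const_add
        (inner ℝ (S.e i) (x * y))
    exact hline.unique h3
  rw [ContinuousLinearMap.det, ← LinearMap.det_toMatrix S.e.toBasis]
  set M := LinearMap.toMatrix S.e.toBasis S.e.toBasis (D : G →ₗ[ℝ] G) with hM
  have hMij : ∀ i j, M i j = inner ℝ (S.e i) (D (S.e j)) := by
    intro i j
    rw [hM, LinearMap.toMatrix_apply, OrthonormalBasis.coe_toBasis_repr_apply,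
      S.e.repr_apply_apply, S.e.coe_toBasis]
    rfl
  -- The entries above the diagonal blocks vanish, while `BlockTriangular` asks for zeros below
  -- them; hence the transpose.
  have htri : M.transpose.BlockTriangular S.deg := by
    intro i j hij
    rw [Matrix.transpose_apply, hMij, key _ _ hij.le]
    refine S.e.inner_eq_zero ?_
    rintro rfl
    exact lt_irrefl _ hij
  rw [← Matrix.det_transpose, htri.det]
  refine Finset.prod_eq_one fun k _ => ?_
  have : M.transpose.toSquareBlock S.deg k = 1 := by
    ext ⟨i, hi⟩ ⟨j, hj⟩
    rw [Matrix.toSquareBlock_def, Matrix.of_apply, Matrix.transpose_apply, hMij,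
      key _ _ (hj.trans hi.symm).le, S.e.inner_eq_ite, Matrix.one_apply]
    simp [eq_comm]
  rw [this, Matrix.det_one]

variable [MeasurableSpace G] [BorelSpace G]

/-- Lebesgue measure is invariant under right translations. -/
theorem measurePreserving_mul_right (S : StratifiedGroup G) (y : G) :
    MeasurePreserving (fun x : G => x * y) (volume : Measure G) volume := by
  have hcd : ContDiff ℝ 1 (fun z : G => z * y) :=
    S.contDiff_mul.comp (contDiff_id.prodMk contDiff_const)
  refine ⟨hcd.continuous.measurable, ?_⟩
  ext s hs
  rw [Measure.map_apply hcd.continuous.measurable hs]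
  have h := lintegral_abs_det_fderiv_eq_addHaar_image volume
    (hcd.continuous.measurable hs)
    (fun x _ => ((hcd.differentiable one_ne_zero) x).hasFDerivAt.hasFDerivWithinAt)
    ((mul_left_injective y).injOn)
  rw [Set.image_preimage_eq _ (mul_right_surjective y)] at h
  simpa [S.det_fderiv_mul_right] using h

theorem integral_mul_inv_right (S : StratifiedGroup G) (g : G → ℝ) (y : G) :
    ∫ x, g (x * y⁻¹) = ∫ x, g x := by
  have hmeas : MeasurableEmbedding (fun x : G => x * y⁻¹) :=
    (Homeomorph.mk (Equiv.mulRight y⁻¹)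
      (S.continuous_mul'.comp (continuous_id.prodMk continuous_const))
      (S.continuous_mul'.comp (continuous_id.prodMk continuous_const))).measurableEmbedding
  exact (S.measurePreserving_mul_right y⁻¹).integral_comp hmeas g

theorem integral_rescale (S : StratifiedGroup G) {ρ : G → ℝ} (hρ : Continuous ρ) {ε : ℝ}
    (hε : 0 < ε) : ∫ x, S.rescale ρ ε x = ∫ x, ρ x := by
  have hdet : LinearMap.det (S.dilationLin (1 / ε)) ≠ 0 := by
    rw [det_dilationLin]
    positivity
  have hL : Continuous (S.dilationLin (1 / ε)) := LinearMap.continuous_of_finiteDimensional _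
  have h := Measure.map_linearMap_addHaar_eq_smul_addHaar (volume : Measure G) hdet
  have h2 := integral_map (μ := (volume : Measure G)) hL.aemeasurable (f := ρ)
    (hρ.aestronglyMeasurable)
  rw [h, integral_smul_measure, det_dilationLin] at h2
  simp only [rescale]
  rw [integral_const_mul]
  change _ * ∫ x, ρ (S.dilationLin (1 / ε) x) = _
  rw [← h2, ENNReal.toReal_ofReal (abs_nonneg _), abs_of_nonneg (by positivity)]
  simp only [smul_eq_mul, one_div, inv_pow, inv_inv]
  rw [← mul_assoc, inv_mul_cancel₀ (by positivity), one_mul]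

end Haar

/-! ### Homogeneous distances, right inner parts and rescaled kernels -/

section HomogeneousDist

variable {G : Type*} [NormedAddCommGroup G] [InnerProductSpace ℝ G] [Group G]
  {S : StratifiedGroup G} {d : G → G → ℝ}

theorem IsHomogeneousDist.nonneg (hd : S.IsHomogeneousDist d) (x y : G) : 0 ≤ d x y := by
  have h1 := hd.triangle x y x
  rw [(hd.eq_zero_iff x x).2 rfl, hd.symm y x] at h1
  linarith

theorem IsHomogeneousDist.mul_le (hd : S.IsHomogeneousDist d) (a b : G) :
    d (a * b) 0 ≤ d a 0 + d b 0 := by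
  have h1 := hd.triangle (a * b) a 0
  have h2 := hd.left_invariant a b 0
  rw [S.mul_zero'] at h2
  linarith

theorem IsHomogeneousDist.dilation (hd : S.IsHomogeneousDist d) {r : ℝ} (hr : 0 < r) (x : G) :
    d (S.dilation r x) 0 = r * d x 0 := by
  rw [← hd.homogeneous r x 0 hr, S.dilation_zero]

theorem IsHomogeneousDist.continuous_left (hd : S.IsHomogeneousDist d) :
    Continuous fun x => d x 0 :=
  hd.continuous.comp (continuous_id.prodMk continuous_const)

/-- For y = z⁻¹x one has xy⁻¹ = z, so this y would be a point of the complement at right distance at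
most ε. -/
theorem mem_of_mem_rightInner {G : Type*} [NormedAddCommGroup G] [Group G]
    {d : G → G → ℝ} {Ω : Set G} {ε : ℝ}
    {x z : G} (hx : x ∈ rightInner d Ω ε) (hz : d z 0 ≤ ε) : z⁻¹ * x ∈ Ω := by
  by_contra h
  have h1 : ENNReal.ofReal ε < ⨅ y ∈ Ωᶜ, ENNReal.ofReal (d (x * y⁻¹) 0) := hx
  have h2 : ⨅ y ∈ Ωᶜ, ENNReal.ofReal (d (x * y⁻¹) 0) ≤
      ENNReal.ofReal (d (x * (z⁻¹ * x)⁻¹) 0) :=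
    iInf₂_le (z⁻¹ * x) h
  have h3 := h1.trans_le h2
  simp only [mul_inv_rev, inv_inv, mul_inv_cancel_left] at h3
  exact absurd (ENNReal.ofReal_le_ofReal hz) (not_le.2 h3)

theorem continuous_rescale (S : StratifiedGroup G) {ρ : G → ℝ} (hρ : Continuous ρ) (ε : ℝ) :
    Continuous (S.rescale ρ ε) :=
  continuous_const.mul
    (hρ.comp (S.continuous_dilation.comp (continuous_const.prodMk continuous_id)))

variable [FiniteDimensional ℝ G]

/-- Small balls of a homogeneous distance are small for the linear topology. -/
theorem IsHomogeneousDist.exists_ball_subset (hd : S.IsHomogeneousDist d) {V : Set G}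
    (hV : V ∈ 𝓝 (0 : G)) : ∃ r > 0, ∀ z, d z 0 < r → z ∈ V := by
  obtain ⟨η, hη, hηV⟩ := Metric.mem_nhds_iff.1 hV
  rcases (Metric.sphere (0 : G) η).eq_empty_or_nonempty with hemp | hne
  · obtain ⟨j, -⟩ := S.exists_deg_eq_step
    exfalso
    have : η • S.e j ∈ Metric.sphere (0 : G) η := by
      simp [norm_smul, abs_of_pos hη, S.e.norm_eq_one]
    rw [hemp] at this
    exact this
  obtain ⟨w, hw, hmin⟩ := (isCompact_sphere (0 : G) η).exists_isMinOn hne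
    hd.continuous_left.continuousOn
  have hw0 : w ≠ 0 := by
    rintro rfl
    simp at hw
    exact hη.ne hw
  have hwpos : 0 < d w 0 :=
    lt_of_le_of_ne (hd.nonneg _ _) fun h => hw0 ((hd.eq_zero_iff _ _).1 h.symm)
  refine ⟨d w 0, hwpos, fun z hz => hηV ?_⟩
  by_contra hzη
  have hzη' : η ≤ ‖z‖ := by simpa using hzη
  -- If ‖z‖ ≥ η, some dilation with factor r in (0,1] brings z onto the sphere, where d(·,0) is at
  -- least its minimum d(w,0); homogeneity then contradicts d(z,0) < d(w,0).
  have hcont : ContinuousOn (fun r : ℝ => ‖S.dilation r z‖) (Set.Icc 0 1) :=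
    (S.continuous_dilation.comp (continuous_id.prodMk continuous_const)).norm.continuousOn
  obtain ⟨r, hr, hrz⟩ := intermediate_value_Icc zero_le_one hcont
    (show η ∈ Set.Icc _ _ by simp [S.dilation_zero_left, S.dilation_one, hη.le, hzη'])
  have hr0 : 0 < r := by
    refine lt_of_le_of_ne hr.1 ?_
    rintro rfl
    simp only [S.dilation_zero_left, norm_zero] at hrz
    exact hη.ne hrz
  have h1 : d w 0 ≤ d (S.dilation r z) 0 := hmin (by simpa using hrz)
  rw [hd.dilation hr0] at h1
  have h2 : r * d z 0 ≤ 1 * d z 0 := mul_le_mul_of_nonneg_right hr.2 (hd.nonneg _ _)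
  linarith

theorem continuous_inv_mul (S : StratifiedGroup G) :
    Continuous fun p : G × G => p.1⁻¹ * p.2 :=
  S.continuous_mul'.comp ((S.continuous_inv'.comp continuous_fst).prodMk continuous_snd)

theorem continuous_mul_inv (S : StratifiedGroup G) :
    Continuous fun p : G × G => p.1 * p.2⁻¹ :=
  S.continuous_mul'.comp (continuous_fst.prodMk (S.continuous_inv'.comp continuous_snd))

theorem IsHomogeneousDist.isOpen_rightInner (hd : S.IsHomogeneousDist d) (Ω : Set G) {ε : ℝ}
    (hε : 0 ≤ ε) : IsOpen (rightInner d Ω ε) := by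
  rw [isOpen_iff_mem_nhds]
  intro x hx
  obtain ⟨c, hc1, hc2⟩ := exists_between (show ENNReal.ofReal ε <
    ⨅ y ∈ Ωᶜ, ENNReal.ofReal (d (x * y⁻¹) 0) from hx)
  have hctop : c ≠ ⊤ := ne_top_of_lt hc2
  have hc : ε < c.toReal := (ENNReal.ofReal_lt_iff_lt_toReal hε hctop).1 hc1
  -- The infimum over y is only known to be at least a lower bound, so an intermediate `b > ε` is
  -- used to keep the inequality strict.
  obtain ⟨b, hb1, hb2⟩ := exists_between hc
  have hcont : Continuous fun x' => d (x * x'⁻¹) 0 :=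
    hd.continuous_left.comp (S.continuous_mul_inv.comp (continuous_const.prodMk continuous_id))
  have hnhds : ∀ᶠ x' in 𝓝 x, d (x * x'⁻¹) 0 < c.toReal - b := by
    refine hcont.continuousAt.eventually_lt continuousAt_const ?_
    rw [mul_inv_cancel, S.one_eq_zero, (hd.eq_zero_iff _ _).2 rfl]
    linarith
  filter_upwards [hnhds] with x' hx'
  refine lt_of_lt_of_le ((ENNReal.ofReal_lt_ofReal_iff (hε.trans_lt hb1)).2 hb1) ?_
  refine le_iInf₂ fun y hy => ENNReal.ofReal_le_ofReal ?_
  have h1 := hd.mul_le (x * x'⁻¹) (x' * y⁻¹)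
  rw [show x * x'⁻¹ * (x' * y⁻¹) = x * y⁻¹ by group] at h1
  have h2 : c < ENNReal.ofReal (d (x * y⁻¹) 0) := lt_of_lt_of_le hc2 (iInf₂_le _ hy)
  have h3 : c.toReal ≤ d (x * y⁻¹) 0 := by
    have := ENNReal.toReal_mono ENNReal.ofReal_ne_top h2.le
    rwa [ENNReal.toReal_ofReal (hd.nonneg _ _)] at this
  linarith

/-- An open set that contains `{0} × K`, with `K` compact, contains the product of a ball and `K`. -/
theorem IsHomogeneousDist.exists_ball_prod (hd : S.IsHomogeneousDist d) {K : Set G}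
    (hK : IsCompact K) {W : Set (G × G)} (hW : IsOpen W) (hKW : ∀ x ∈ K, ((0 : G), x) ∈ W) :
    ∃ r > 0, ∀ z, d z 0 < r → ∀ x ∈ K, (z, x) ∈ W := by
  obtain ⟨u, v, hu, -, hu0, hKv, huv⟩ := generalized_tube_lemma (isCompact_singleton (x := (0 : G)))
    hK hW (by
      rintro ⟨a, b⟩ ⟨ha, hb⟩
      obtain rfl : a = 0 := ha
      exact hKW b hb)
  obtain ⟨r, hr, hru⟩ := hd.exists_ball_subset (hu.mem_nhds (hu0 rfl))
  exact ⟨r, hr, fun z hz x hx => huv ⟨hru z hz, hKv hx⟩⟩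

/-- For x in K and y outside Ω, the point z = xy⁻¹ satisfies z⁻¹x = y, so z lies outside any ball on
which (z,x) ↦ z⁻¹x stays in Ω. -/
theorem IsHomogeneousDist.exists_subset_rightInner (hd : S.IsHomogeneousDist d) {Ω K : Set G}
    (hΩ : IsOpen Ω) (hK : IsCompact K) (hKΩ : K ⊆ Ω) :
    ∃ r > 0, ∀ ε < r, K ⊆ rightInner d Ω ε := by
  obtain ⟨r, hr, h⟩ := hd.exists_ball_prod hK (hΩ.preimage S.continuous_inv_mul)
    (fun x hx => by simpa [S.inv_eq_neg, S.zero_mul'] using hKΩ hx)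
  refine ⟨r, hr, fun ε hε x hx => ?_⟩
  refine lt_of_lt_of_le ((ENNReal.ofReal_lt_ofReal_iff hr).2 hε) ?_
  refine le_iInf₂ fun y hy => ENNReal.ofReal_le_ofReal ?_
  by_contra hlt
  have := h _ (not_le.1 hlt) x hx
  simp only [Set.mem_preimage, mul_inv_rev, inv_inv, inv_mul_cancel_right] at this
  exact hy this

/-- Uniform continuity for left multiplication by small elements. The compact set `K` enlarges the
support enough that for y outside it and z in the unit ball both y and zy miss the support; on `K`
the tube lemma applies. -/
theorem IsHomogeneousDist.exists_norm_sub_le (hd : S.IsHomogeneousDist d) {E : Type*}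
    [NormedAddCommGroup E] {φ : G → E} (hφ : Continuous φ) (hc : HasCompactSupport φ) {η : ℝ}
    (hη : 0 < η) : ∃ r > 0, ∀ z, d z 0 < r → ∀ y, ‖φ (z * y) - φ y‖ ≤ η := by
  set K : Set G := (fun p : G × G => p.1⁻¹ * p.2) '' (Metric.closedBall 0 1 ×ˢ tsupport φ) with hKdef
  have hK : IsCompact K :=
    ((isCompact_closedBall _ _).prod hc).image S.continuous_inv_mul
  have hWo : IsOpen {p : G × G | ‖φ (p.1 * p.2) - φ p.2‖ < η} :=
    isOpen_lt (((hφ.comp S.continuous_mul').sub (hφ.comp continuous_snd)).norm) continuous_const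
  obtain ⟨r₁, hr₁, h₁⟩ := hd.exists_ball_prod hK hWo
    (fun x _ => by simpa [S.zero_mul'] using hη)
  obtain ⟨r₂, hr₂, h₂⟩ := hd.exists_ball_subset (Metric.closedBall_mem_nhds (0 : G) one_pos)
  refine ⟨min r₁ r₂, lt_min hr₁ hr₂, fun z hz y => ?_⟩
  by_cases hy : y ∈ K
  · exact (h₁ z (hz.trans_le (min_le_left _ _)) y hy).le
  · have e1 : φ (z * y) = 0 := by
      refine image_eq_zero_of_notMem_tsupport fun h => hy ?_
      exact ⟨(z, z * y), ⟨h₂ z (hz.trans_le (min_le_right _ _)), h⟩, by simp⟩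
    have e2 : φ y = 0 := by
      refine image_eq_zero_of_notMem_tsupport fun h => hy ?_
      exact ⟨(0, y), ⟨by simp, h⟩, by simp [S.inv_eq_neg, S.zero_mul']⟩
    simp [e1, e2, hη.le]

theorem IsHomogeneousDist.eventually_subset_rightInner (hd : S.IsHomogeneousDist d)
    {Ω K : Set G} (hΩ : IsOpen Ω) (hK : IsCompact K) (hKΩ : K ⊆ Ω) :
    ∀ᶠ ε in 𝓝[>] (0 : ℝ), K ⊆ rightInner d Ω (2 * ε) := by
  obtain ⟨r, hr, hsub⟩ := hd.exists_subset_rightInner hΩ hK hKΩ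
  filter_upwards [Ioo_mem_nhdsGT (half_pos hr)] with ε hε
  exact hsub _ (by linarith [hε.2])

theorem continuous_rescale_mul_inv (S : StratifiedGroup G) {ρ : G → ℝ} (hρ : Continuous ρ) (ε : ℝ) :
    Continuous fun p : G × G => S.rescale ρ ε (p.1 * p.2⁻¹) :=
  (S.continuous_rescale hρ ε).comp S.continuous_mul_inv

variable [MeasurableSpace G] [BorelSpace G] {ρ : G → ℝ}

theorem IsSymmMollifier.rescale_nonneg (hρ : IsSymmMollifier d ρ) {ε : ℝ} (hε : 0 < ε) (x : G) :
    0 ≤ S.rescale ρ ε x :=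
  mul_nonneg (by positivity) (hρ.nonneg _)

theorem tsupport_rescale_subset (hρ : IsSymmMollifier d ρ) {ε : ℝ} (hε : 0 < ε) :
    tsupport (S.rescale ρ ε) ⊆ S.dilation ε '' tsupport ρ := by
  have hdc : ∀ r, Continuous (S.dilation r) := fun r =>
    S.continuous_dilation.comp (continuous_const.prodMk continuous_id)
  refine closure_minimal (fun x hx => ?_)
    (hρ.hasCompactSupport.isCompact.image (hdc ε)).isClosed
  refine ⟨S.dilation (1 / ε) x, subset_tsupport _ ?_, ?_⟩
  · exact right_ne_zero_of_mul hx
  · rw [S.dilation_dilation, mul_one_div_cancel hε.ne', S.dilation_one]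

theorem hasCompactSupport_rescale (hρ : IsSymmMollifier d ρ) {ε : ℝ} (hε : 0 < ε) :
    HasCompactSupport (S.rescale ρ ε) :=
  (hρ.hasCompactSupport.isCompact.image
    (S.continuous_dilation.comp (continuous_const.prodMk continuous_id))).of_isClosed_subset
    (isClosed_tsupport _) (tsupport_rescale_subset hρ hε)

theorem IsHomogeneousDist.lt_of_mem_tsupport_rescale (hd : S.IsHomogeneousDist d)
    (hρ : IsSymmMollifier d ρ) {ε : ℝ} (hε : 0 < ε) {x : G}
    (hx : x ∈ tsupport (S.rescale ρ ε)) : d x 0 < ε := by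
  obtain ⟨w, hw, rfl⟩ := tsupport_rescale_subset hρ hε hx
  rw [hd.dilation hε]
  have : d w 0 < 1 := hρ.tsupport_subset hw
  nlinarith

end HomogeneousDist

/-! ### Test fields, horizontal divergence and left invariant derivatives -/

section TestField

variable {G : Type*} [NormedAddCommGroup G] [InnerProductSpace ℝ G] [Group G]

theorem leftDeriv_eq_zero (S : StratifiedGroup G) (j : S.HorIdx) {g : G → ℝ} {x : G}
    (hx : x ∉ tsupport g) (hc : Continuous fun t : ℝ => x * (t • S.e j.1)) :
    S.leftDeriv j g x = 0 := by
  have h0 : Tendsto (fun t : ℝ => x * (t • S.e j.1)) (𝓝 0) (𝓝 x) := by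
    simpa [S.mul_zero'] using hc.tendsto 0
  have h1 : (fun t : ℝ => g (x * (t • S.e j.1))) =ᶠ[𝓝 0] fun _ => 0 :=
    h0.eventually (notMem_tsupport_iff_eventuallyEq.1 hx)
  rw [leftDeriv, h1.deriv_eq, deriv_const]

theorem IsTestField.mono {S : StratifiedGroup G} {U W : Set G} {φ : G → S.Hor}
    (h : S.IsTestField U φ) (hUW : U ⊆ W) : S.IsTestField W φ :=
  ⟨h.1, h.2.1, h.2.2.trans hUW⟩

theorem IsTestField.add {S : StratifiedGroup G} {U : Set G} {φ ψ : G → S.Hor}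
    (hφ : S.IsTestField U φ) (hψ : S.IsTestField U ψ) : S.IsTestField U (φ + ψ) :=
  ⟨hφ.1.add hψ.1, hφ.2.1.add hψ.2.1,
    (tsupport_add φ ψ).trans (Set.union_subset hφ.2.2 hψ.2.2)⟩

theorem IsTestField.of_support_subset {S : StratifiedGroup G} {U : Set G} {φ ψ : G → S.Hor}
    (hφ : S.IsTestField U φ) (hψ : ContDiff ℝ 1 ψ) (h : ∀ x, φ x = 0 → ψ x = 0) :
    S.IsTestField U ψ := by
  have hs : tsupport ψ ⊆ tsupport φ := closure_mono fun x hx h0 => hx (h x h0)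
  exact ⟨hψ, hφ.2.1.of_isClosed_subset (isClosed_tsupport _) hs, hs.trans hφ.2.2⟩

theorem IsTestField.mul {S : StratifiedGroup G} {U : Set G} {φ : G → S.Hor}
    (hφ : S.IsTestField U φ) {u : G → ℝ} (hu : ContDiff ℝ 1 u) :
    S.IsTestField U (fun x => u x • φ x) :=
  hφ.of_support_subset (hu.smul hφ.1) fun x hx => by rw [hx, smul_zero]

theorem IsTestField.smul {S : StratifiedGroup G} {U : Set G} {φ : G → S.Hor}
    (hφ : S.IsTestField U φ) (c : ℝ) : S.IsTestField U (c • φ) :=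
  hφ.of_support_subset (contDiff_const.smul hφ.1) fun x hx => by
    rw [Pi.smul_apply, hx, smul_zero]

theorem isTestField_zero (S : StratifiedGroup G) (U : Set G) : S.IsTestField U 0 :=
  ⟨contDiff_const, HasCompactSupport.zero, by simp⟩

theorem tsupport_component_subset {S : StratifiedGroup G} (φ : G → S.Hor) (j : S.HorIdx) :
    tsupport (fun y => φ y j) ⊆ tsupport φ :=
  closure_mono fun x hx h0 => hx (by simp [h0])

theorem contDiff_component {S : StratifiedGroup G} {φ : G → S.Hor} (hφ : ContDiff ℝ 1 φ)
    (j : S.HorIdx) : ContDiff ℝ 1 fun y => φ y j :=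
  (EuclideanSpace.proj (𝕜 := ℝ) j).contDiff.comp hφ

theorem horDiv_smul (S : StratifiedGroup G) (φ : G → S.Hor) (c : ℝ) (x : G) :
    S.horDiv (c • φ) x = c * S.horDiv φ x := by
  simp only [horDiv, Finset.mul_sum]
  refine Finset.sum_congr rfl fun j _ => ?_
  exact deriv_const_mul_field c

variable [FiniteDimensional ℝ G]

/-- The value at `x` of the left invariant vector field `X_j`, as a vector of the linear
space `G`. -/
def leftField (S : StratifiedGroup G) (j : S.HorIdx) (x : G) : G :=
  fderiv ℝ (fun p : G × G => p.1 * p.2) (x, 0) (0, S.e j.1)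

theorem continuous_leftField (S : StratifiedGroup G) (j : S.HorIdx) :
    Continuous (S.leftField j) :=
  (((S.contDiff_mul (n := 1)).continuous_fderiv one_ne_zero).comp
    (continuous_id.prodMk continuous_const)).clm_apply continuous_const

theorem hasDerivAt_mul_smul (S : StratifiedGroup G) (j : S.HorIdx) (x : G) :
    HasDerivAt (fun t : ℝ => x * (t • S.e j.1)) (S.leftField j x) 0 := by
  have h1 : HasDerivAt (fun t : ℝ => (x, t • S.e j.1)) ((0 : G), S.e j.1) 0 := by
    simpa using (hasDerivAt_const (0 : ℝ) x).prodMk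
      ((hasDerivAt_id (0 : ℝ)).smul_const (S.e j.1))
  have h2 : HasFDerivAt (fun p : G × G => p.1 * p.2)
      (fderiv ℝ (fun p : G × G => p.1 * p.2) (x, 0)) (x, (0 : ℝ) • S.e j.1) := by
    rw [zero_smul]
    exact ((S.contDiff_mul (n := 1)).differentiable one_ne_zero (x, 0)).hasFDerivAt
  exact h2.comp_hasDerivAt (0 : ℝ) h1

theorem hasDerivAt_comp_mul_smul (S : StratifiedGroup G) (j : S.HorIdx) {g : G → ℝ} {x : G}
    (hg : DifferentiableAt ℝ g x) :
    HasDerivAt (fun t : ℝ => g (x * (t • S.e j.1))) (fderiv ℝ g x (S.leftField j x)) 0 := by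
  have h2 : HasFDerivAt g (fderiv ℝ g x) (x * ((0 : ℝ) • S.e j.1)) := by
    rw [zero_smul, S.mul_zero']
    exact hg.hasFDerivAt
  exact h2.comp_hasDerivAt (0 : ℝ) (S.hasDerivAt_mul_smul j x)

theorem leftDeriv_eq (S : StratifiedGroup G) (j : S.HorIdx) {g : G → ℝ} {x : G}
    (hg : DifferentiableAt ℝ g x) :
    S.leftDeriv j g x = fderiv ℝ g x (S.leftField j x) :=
  (S.hasDerivAt_comp_mul_smul j hg).deriv

theorem continuous_leftDeriv (S : StratifiedGroup G) (j : S.HorIdx) {g : G → ℝ}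
    (hg : ContDiff ℝ 1 g) : Continuous (S.leftDeriv j g) := by
  have : S.leftDeriv j g = fun x => fderiv ℝ g x (S.leftField j x) := by
    funext x
    exact S.leftDeriv_eq j (hg.differentiable one_ne_zero x)
  rw [this]
  exact (hg.continuous_fderiv one_ne_zero).clm_apply (S.continuous_leftField j)

theorem continuous_horDiv (S : StratifiedGroup G) {φ : G → S.Hor} (hφ : ContDiff ℝ 1 φ) :
    Continuous (S.horDiv φ) :=
  continuous_finsetSum _ fun j _ => S.continuous_leftDeriv j (contDiff_component hφ j)

theorem horDiv_eq_zero (S : StratifiedGroup G) (φ : G → S.Hor) {x : G} (hx : x ∉ tsupport φ) :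
    S.horDiv φ x = 0 :=
  Finset.sum_eq_zero fun j _ => S.leftDeriv_eq_zero j
    (fun h => hx (tsupport_component_subset φ j h))
    (S.continuous_mul'.comp (continuous_const.prodMk (continuous_id.smul continuous_const)))

theorem horDiv_add (S : StratifiedGroup G) {φ ψ : G → S.Hor} (hφ : ContDiff ℝ 1 φ)
    (hψ : ContDiff ℝ 1 ψ) (x : G) : S.horDiv (φ + ψ) x = S.horDiv φ x + S.horDiv ψ x := by
  simp only [horDiv]
  rw [← Finset.sum_add_distrib]
  refine Finset.sum_congr rfl fun j _ => ?_
  exact ((S.hasDerivAt_comp_mul_smul j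
    ((contDiff_component hφ j).differentiable one_ne_zero x)).differentiableAt.hasDerivAt.add
    (S.hasDerivAt_comp_mul_smul j
    ((contDiff_component hψ j).differentiable one_ne_zero x)).differentiableAt.hasDerivAt).deriv

/-! ### The distributional pairing and the variation measure -/

variable [MeasurableSpace G] [BorelSpace G]

theorem IsBVHLoc.integrableOn {S : StratifiedGroup G} {Ω : Set G} {f : G → ℝ}
    (hf : S.IsBVHLoc Ω f) (hΩ : IsOpen Ω) {K : Set G} (hK : IsCompact K) (hKΩ : K ⊆ Ω) :
    IntegrableOn f K := by
  obtain ⟨U, hU, hKU, hUΩ, hUc⟩ := exists_open_between_and_isCompact_closure hK hΩ hKΩ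
  exact (hf U hU hUc hUΩ).1.mono_set hKU

/-- A locally integrable function times a continuous function with compact support in `Ω` is
integrable. -/
theorem IsBVHLoc.integrable_mul {S : StratifiedGroup G} {Ω : Set G} {f : G → ℝ}
    (hf : S.IsBVHLoc Ω f) (hΩ : IsOpen Ω) {K : Set G} (hK : IsCompact K) (hKΩ : K ⊆ Ω)
    {h : G → ℝ} (hc : Continuous h) (h0 : ∀ x ∉ K, h x = 0) :
    Integrable fun x => f x * h x := by
  rw [← integrableOn_iff_integrable_of_support_subset (s := K)]
  · exact (hf.integrableOn hΩ hK hKΩ).mul_continuousOn hc.continuousOn hK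
  · intro x hx
    by_contra hxK
    exact hx (by simp [h0 x hxK])

/-- The distributional pairing `φ ↦ ∫ f div φ`. -/
def divPairing (S : StratifiedGroup G) (f : G → ℝ) (φ : G → S.Hor) : ℝ :=
  ∫ x, f x * S.horDiv φ x

theorem setIntegral_eq_divPairing (S : StratifiedGroup G) (f : G → ℝ) {U : Set G}
    {φ : G → S.Hor} (hφ : tsupport φ ⊆ U) :
    ∫ x in U, f x * S.horDiv φ x = S.divPairing f φ :=
  setIntegral_eq_integral_of_forall_compl_eq_zero fun x hx => by
    rw [S.horDiv_eq_zero φ fun h => hx (hφ h), mul_zero]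

variable {S : StratifiedGroup G} {Ω : Set G} {f : G → ℝ}

theorem IsBVHLoc.integrable_mul_horDiv (hf : S.IsBVHLoc Ω f) (hΩ : IsOpen Ω) {φ : G → S.Hor}
    (hφ : S.IsTestField Ω φ) : Integrable fun x => f x * S.horDiv φ x :=
  hf.integrable_mul hΩ hφ.2.1 hφ.2.2 (S.continuous_horDiv hφ.1) fun _ hx =>
    S.horDiv_eq_zero φ hx

theorem IsBVHLoc.divPairing_add (hf : S.IsBVHLoc Ω f) (hΩ : IsOpen Ω) {φ ψ : G → S.Hor}
    (hφ : S.IsTestField Ω φ) (hψ : S.IsTestField Ω ψ) :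
    S.divPairing f (φ + ψ) = S.divPairing f φ + S.divPairing f ψ := by
  rw [divPairing, divPairing, divPairing,
    ← integral_add (hf.integrable_mul_horDiv hΩ hφ) (hf.integrable_mul_horDiv hΩ hψ)]
  refine integral_congr_ae (.of_forall fun x => ?_)
  simp only [S.horDiv_add hφ.1 hψ.1, mul_add]

theorem divPairing_smul (S : StratifiedGroup G) (f : G → ℝ) (φ : G → S.Hor) (c : ℝ) :
    S.divPairing f (c • φ) = c * S.divPairing f φ := by
  rw [divPairing, divPairing, ← integral_const_mul]
  refine integral_congr_ae (.of_forall fun x => ?_)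
  simp only [S.horDiv_smul]
  ring

theorem divPairing_zero (S : StratifiedGroup G) (f : G → ℝ) : S.divPairing f 0 = 0 := by
  have := S.divPairing_smul f 0 0
  rwa [zero_smul, zero_mul] at this

theorem divPairing_le_hVariation {U : Set G} {φ : G → S.Hor} (hφ : S.IsTestField U φ)
    (h1 : ∀ x, ‖φ x‖ ≤ 1) : ENNReal.ofReal (S.divPairing f φ) ≤ S.hVariation f U := by
  rw [← S.setIntegral_eq_divPairing f hφ.2.2]
  exact le_iSup₂ (f := fun (φ : G → S.Hor) (_ : S.IsTestField U φ ∧ ∀ x, ‖φ x‖ ≤ 1) =>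
    ENNReal.ofReal (∫ x in U, f x * S.horDiv φ x)) φ ⟨hφ, h1⟩

theorem hVariation_le {U : Set G} {a : ENNReal} (h : ∀ φ : G → S.Hor, S.IsTestField U φ →
    (∀ x, ‖φ x‖ ≤ 1) → ENNReal.ofReal (S.divPairing f φ) ≤ a) : S.hVariation f U ≤ a :=
  iSup₂_le fun φ hφ => by
    rw [S.setIntegral_eq_divPairing f hφ.1.2.2]
    exact h φ hφ.1 hφ.2

theorem hVariation_mono {U W : Set G} (h : U ⊆ W) : S.hVariation f U ≤ S.hVariation f W :=
  hVariation_le fun _ hφ h1 => divPairing_le_hVariation (hφ.mono h) h1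

theorem divPairing_le_mul {U : Set G} {φ : G → S.Hor} (hφ : S.IsTestField U φ) {c : ℝ}
    (hc : 0 < c) (h1 : ∀ x, ‖φ x‖ ≤ c) (hU : S.hVariation f U ≠ ⊤) :
    S.divPairing f φ ≤ c * (S.hVariation f U).toReal := by
  have h := divPairing_le_hVariation (f := f) (hφ.smul c⁻¹) (fun x => by
    rw [Pi.smul_apply, norm_smul, norm_inv, Real.norm_of_nonneg hc.le, inv_mul_le_iff₀ hc, mul_one]
    exact h1 x)
  rw [divPairing_smul, ENNReal.ofReal_le_iff_le_toReal hU, inv_mul_le_iff₀ hc] at h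
  exact h

/-- The support of φ splits into compact K₁ ⊆ U and K₂ ⊆ W. A C¹ cutoff u, equal to 1 exactly on K₁
and supported in U, places uφ in U and (1 − u)φ in W; the factors lie in [0,1], so both fields are
admissible. -/
theorem IsBVHLoc.hVariation_union_le (hf : S.IsBVHLoc Ω f) (hΩ : IsOpen Ω) {U W : Set G}
    (hU : IsOpen U) (hW : IsOpen W) (hUΩ : U ⊆ Ω) (hWΩ : W ⊆ Ω) :
    S.hVariation f (U ∪ W) ≤ S.hVariation f U + S.hVariation f W := by
  refine hVariation_le fun φ hφ h1 => ?_
  obtain ⟨K₁, K₂, hK₁, hK₂, hK₁U, hK₂W, hK⟩ :=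
    IsCompact.binary_compact_cover hφ.2.1 hU hW hφ.2.2
  obtain ⟨V, hV, hK₁V, hVU, hVc⟩ := exists_open_between_and_isCompact_closure hK₁ hU hK₁U
  obtain ⟨u, hu, hur, hus, hu1⟩ := exists_contMDiff_support_eq_eq_one_iff
    (n := (1 : ℕ∞)) (modelWithCornersSelf ℝ G) hV hK₁.isClosed hK₁V
  have hu' : ContDiff ℝ 1 u := hu.contDiff
  have hu01 : ∀ x, 0 ≤ u x ∧ u x ≤ 1 := fun x => hur ⟨x, rfl⟩
  have hφΩ := hφ.mono (Set.union_subset hUΩ hWΩ)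
  have t1 : S.IsTestField U fun x => u x • φ x := by
    refine ⟨(hφ.mul hu').1, (hφ.mul hu').2.1, Set.Subset.trans (closure_mono fun x hx => ?_) hVU⟩
    rw [← hus]
    exact left_ne_zero_of_smul hx
  have t2 : S.IsTestField W fun x => (1 - u x) • φ x := by
    have hm := hφ.mul ((contDiff_const (c := (1 : ℝ))).sub hu')
    refine ⟨hm.1, hm.2.1, ?_⟩
    refine (closure_minimal (fun x hx => ?_) hK₂.isClosed).trans hK₂W
    have hx1 : x ∈ tsupport φ := subset_tsupport _ (right_ne_zero_of_smul hx)
    have hx2 : 1 - u x ≠ 0 := left_ne_zero_of_smul hx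
    rw [hK] at hx1
    refine hx1.resolve_left fun hxK => hx2 ?_
    rw [(hu1 x).1 hxK, sub_self]
  have hsum : φ = (fun x => u x • φ x) + fun x => (1 - u x) • φ x := by
    funext x
    simp [← add_smul]
  rw [hsum, hf.divPairing_add hΩ (t1.mono hUΩ) (t2.mono hWΩ)]
  refine ENNReal.ofReal_add_le.trans (add_le_add
    (divPairing_le_hVariation t1 fun x => ?_) (divPairing_le_hVariation t2 fun x => ?_))
  · rw [norm_smul, Real.norm_of_nonneg (hu01 x).1]
    exact mul_le_one₀ (hu01 x).2 (norm_nonneg _) (h1 x)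
  · rw [norm_smul, Real.norm_of_nonneg (by linarith [(hu01 x).2])]
    exact mul_le_one₀ (by linarith [(hu01 x).1]) (norm_nonneg _) (h1 x)

/-- At each point at most one of the two fields is nonzero, so their sum is admissible. Negative
pairings are treated apart because `ENNReal.ofReal` truncates them. -/
theorem IsBVHLoc.hVariation_add_le (hf : S.IsBVHLoc Ω f) (hΩ : IsOpen Ω) {U W : Set G}
    (hUW : Disjoint U W) (hUΩ : U ⊆ Ω) (hWΩ : W ⊆ Ω) :
    S.hVariation f U + S.hVariation f W ≤ S.hVariation f (U ∪ W) := by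
  have hU : S.hVariation f U ≤ S.hVariation f (U ∪ W) := hVariation_mono Set.subset_union_left
  have hW : S.hVariation f W ≤ S.hVariation f (U ∪ W) := hVariation_mono Set.subset_union_right
  refine ENNReal.biSup_add_biSup_le' ⟨0, S.isTestField_zero U, by simp⟩
    ⟨0, S.isTestField_zero W, by simp⟩ fun φ hφ ψ hψ => ?_
  rw [S.setIntegral_eq_divPairing f hφ.1.2.2, S.setIntegral_eq_divPairing f hψ.1.2.2]
  rcases le_total (S.divPairing f φ) 0 with h1 | h1
  · rw [ENNReal.ofReal_of_nonpos h1, zero_add]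
    exact (divPairing_le_hVariation hψ.1 hψ.2).trans hW
  rcases le_total (S.divPairing f ψ) 0 with h2 | h2
  · rw [ENNReal.ofReal_of_nonpos h2, add_zero]
    exact (divPairing_le_hVariation hφ.1 hφ.2).trans hU
  rw [← ENNReal.ofReal_add h1 h2,
    ← hf.divPairing_add hΩ (hφ.1.mono hUΩ) (hψ.1.mono hWΩ)]
  refine divPairing_le_hVariation ((hφ.1.mono Set.subset_union_left).add
    (hψ.1.mono Set.subset_union_right)) fun x => ?_
  by_cases hx : x ∈ U
  · have : ψ x = 0 := image_eq_zero_of_notMem_tsupport fun h =>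
      Set.disjoint_left.1 hUW hx (hψ.1.2.2 h)
    simpa [this] using hφ.2 x
  · have : φ x = 0 := image_eq_zero_of_notMem_tsupport fun h => hx (hφ.1.2.2 h)
    simpa [this] using hψ.2 x

/-- The infimum of the h-variations over the neighbourhoods of a set. -/
def outerVariation (S : StratifiedGroup G) (Ω : Set G) (f : G → ℝ) (K : Set G) : ENNReal :=
  ⨅ (U : Set G) (_ : IsOpen U ∧ K ⊆ U), S.hVariation f (U ∩ Ω)

theorem outerVariation_le {K U : Set G} (hU : IsOpen U) (hK : K ⊆ U) :
    S.outerVariation Ω f K ≤ S.hVariation f (U ∩ Ω) :=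
  iInf₂_le (f := fun (U : Set G) (_ : IsOpen U ∧ K ⊆ U) => S.hVariation f (U ∩ Ω)) U ⟨hU, hK⟩

theorem outerVariation_mono {K K' : Set G} (h : K ⊆ K') :
    S.outerVariation Ω f K ≤ S.outerVariation Ω f K' :=
  le_iInf₂ fun _ hU => outerVariation_le hU.1 (h.trans hU.2)

theorem IsBVHLoc.outerVariation_union_le (hf : S.IsBVHLoc Ω f) (hΩ : IsOpen Ω) (K K' : Set G) :
    S.outerVariation Ω f (K ∪ K') ≤ S.outerVariation Ω f K + S.outerVariation Ω f K' := by
  refine ENNReal.le_iInf₂_add_iInf₂ fun U hU W hW => ?_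
  refine (outerVariation_le (hU.1.union hW.1) (Set.union_subset_union hU.2 hW.2)).trans ?_
  rw [Set.union_inter_distrib_right]
  exact hf.hVariation_union_le hΩ (hU.1.inter hΩ) (hW.1.inter hΩ) Set.inter_subset_right
    Set.inter_subset_right

/-- Disjoint compact sets have disjoint open neighbourhoods; inside any neighbourhood of the union,
superadditivity on these applies. -/
theorem IsBVHLoc.outerVariation_add_le (hf : S.IsBVHLoc Ω f) (hΩ : IsOpen Ω) {K K' : Set G}
    (hK : IsCompact K) (hK' : IsCompact K') (hd : Disjoint K K') :
    S.outerVariation Ω f K + S.outerVariation Ω f K' ≤ S.outerVariation Ω f (K ∪ K') := by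
  obtain ⟨U, U', hU, hU', hKU, hKU', hUU⟩ := SeparatedNhds.of_isCompact_isCompact hK hK' hd
  refine le_iInf₂ fun W hW => ?_
  refine (add_le_add
    (outerVariation_le (hU.inter hW.1) (Set.subset_inter hKU
      (Set.subset_union_left.trans hW.2)))
    (outerVariation_le (hU'.inter hW.1) (Set.subset_inter hKU'
      (Set.subset_union_right.trans hW.2)))).trans ?_
  refine (hf.hVariation_add_le hΩ ?_ Set.inter_subset_right Set.inter_subset_right).trans
    (hVariation_mono ?_)
  · exact hUU.mono (Set.inter_subset_left.trans Set.inter_subset_left)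
      (Set.inter_subset_left.trans Set.inter_subset_left)
  · rintro x (hx | hx)
    exacts [⟨hx.1.2, hx.2⟩, ⟨hx.1.2, hx.2⟩]

/-- The content on compact sets induced by the h-variation. -/
def variationContent (hf : S.IsBVHLoc Ω f) (hΩ : IsOpen Ω) (hfΩ : S.hVariation f Ω < ⊤) :
    Content G :=
  have hfin : ∀ K, S.outerVariation Ω f K ≠ ⊤ := fun K =>
    ne_top_of_le_ne_top hfΩ.ne ((outerVariation_le isOpen_univ (Set.subset_univ K)).trans
      (hVariation_mono Set.inter_subset_right))
  { toFun := fun K => (S.outerVariation Ω f K).toNNReal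
    mono' := fun _ _ h => ENNReal.toNNReal_mono (hfin _) (outerVariation_mono h)
    sup_disjoint' := fun K K' hd _ _ => by
      rw [← ENNReal.toNNReal_add (hfin _) (hfin _), TopologicalSpace.Compacts.coe_sup]
      congr 1
      exact le_antisymm (hf.outerVariation_union_le hΩ _ _)
        (hf.outerVariation_add_le hΩ K.isCompact K'.isCompact hd)
    sup_le' := fun K K' => by
      rw [← ENNReal.toNNReal_add (hfin _) (hfin _), TopologicalSpace.Compacts.coe_sup]
      exact ENNReal.toNNReal_mono (ENNReal.add_ne_top.2 ⟨hfin _, hfin _⟩)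
        (hf.outerVariation_union_le hΩ _ _) }

/-- The h-variation is the restriction to open sets of a Borel measure. -/
theorem IsBVHLoc.exists_variation_measure (hf : S.IsBVHLoc Ω f) (hΩ : IsOpen Ω)
    (hfΩ : S.hVariation f Ω < ⊤) :
    ∃ γ : Measure G, γ Ωᶜ = 0 ∧ ∀ U : Set G, IsOpen U → U ⊆ Ω → γ U = S.hVariation f U := by
  set ν := variationContent hf hΩ hfΩ with hν
  have hνK : ∀ K : TopologicalSpace.Compacts G, ν K = S.outerVariation Ω f K := fun K =>
    ENNReal.coe_toNNReal (ne_top_of_le_ne_top hfΩ.ne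
      ((outerVariation_le isOpen_univ (Set.subset_univ _)).trans
      (hVariation_mono Set.inter_subset_right)))
  refine ⟨ν.measure.restrict Ω, ?_, fun U hU hUΩ => ?_⟩
  · rw [Measure.restrict_apply hΩ.measurableSet.compl, Set.compl_inter_self, measure_empty]
  rw [Measure.restrict_apply hU.measurableSet, Set.inter_eq_left.2 hUΩ,
    ν.measure_apply hU.measurableSet, ν.outerMeasure_of_isOpen U hU]
  -- One direction: `U` is itself a neighbourhood of each compact K ⊆ U. The other: the support of a
  -- test field is such a compact set, and the field is admissible in each of its neighbourhoods
  -- intersected with Ω.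
  refine le_antisymm (iSup₂_le fun K hK => ?_) (hVariation_le fun φ hφ h1 => ?_)
  · rw [hνK]
    exact (outerVariation_le hU hK).trans (hVariation_mono Set.inter_subset_left)
  · refine le_trans ?_ (ν.le_innerContent ⟨tsupport φ, hφ.2.1⟩ ⟨U, hU⟩ hφ.2.2)
    rw [hνK]
    refine le_iInf₂ fun W hW => divPairing_le_hVariation ⟨hφ.1, hφ.2.1, ?_⟩ h1
    exact Set.subset_inter hW.2 (hφ.2.2.trans hUΩ)

end TestField

end StratifiedGroup

/-! ### C¹ truncations of the positive part -/

section Ramp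

theorem hasDerivAt_max_zero_sq (s : ℝ) : HasDerivAt (fun r : ℝ => max r 0 ^ 2) (2 * max s 0) s := by
  rcases lt_trichotomy s 0 with h | rfl | h
  · rw [max_eq_right h.le, mul_zero]
    refine (hasDerivAt_const s (0 : ℝ)).congr_of_eventuallyEq ?_
    filter_upwards [Iio_mem_nhds h] with r hr
    rw [max_eq_right (le_of_lt hr)]
    simp
  · rw [max_self, mul_zero, hasDerivAt_iff_isLittleO]
    have h1 : (fun r : ℝ => max r 0 ^ 2 - max 0 0 ^ 2 - (r - 0) • (0 : ℝ)) =O[𝓝 0]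
        fun r : ℝ => r ^ 2 := by
      refine Asymptotics.IsBigO.of_bound 1 (.of_forall fun r => ?_)
      simp only [max_self, smul_zero, sub_zero, one_mul, Real.norm_eq_abs]
      rw [zero_pow two_ne_zero, sub_zero, abs_of_nonneg (by positivity),
        abs_of_nonneg (by positivity)]
      rcases le_total r 0 with h | h
      · rw [max_eq_right h]
        nlinarith [sq_nonneg r]
      · rw [max_eq_left h]
    refine h1.trans_isLittleO ?_
    simpa using Asymptotics.isLittleO_pow_id (𝕜 := ℝ) one_lt_two
  · rw [max_eq_left h.le]
    have : HasDerivAt (fun r : ℝ => r ^ 2) (2 * s) s := by simpa using hasDerivAt_pow 2 s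
    refine this.congr_of_eventuallyEq ?_
    filter_upwards [Ioi_mem_nhds h] with r hr
    rw [max_eq_left (le_of_lt hr)]

theorem contDiff_max_zero_sq : ContDiff ℝ 1 fun r : ℝ => max r 0 ^ 2 := by
  rw [contDiff_one_iff_deriv]
  refine ⟨fun s => (hasDerivAt_max_zero_sq s).differentiableAt, ?_⟩
  have : deriv (fun r : ℝ => max r 0 ^ 2) = fun s => 2 * max s 0 :=
    funext fun s => (hasDerivAt_max_zero_sq s).deriv
  rw [this]
  fun_prop

/-- A `C¹` approximation of the positive part, at scale `δ`. -/
def ramp (δ s : ℝ) : ℝ := (max s 0 ^ 2 - max (s - δ) 0 ^ 2) / (2 * δ)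

theorem contDiff_ramp (δ : ℝ) : ContDiff ℝ 1 (ramp δ) :=
  (contDiff_max_zero_sq.sub (contDiff_max_zero_sq.comp (contDiff_id.sub contDiff_const))).div_const
    _

variable {δ : ℝ}

theorem ramp_of_nonpos (hδ : 0 < δ) {s : ℝ} (hs : s ≤ 0) : ramp δ s = 0 := by
  rw [ramp, max_eq_right hs, max_eq_right (by linarith)]
  simp

theorem ramp_of_mem {s : ℝ} (h0 : 0 ≤ s) (h1 : s ≤ δ) :
    ramp δ s = s ^ 2 / (2 * δ) := by
  rw [ramp, max_eq_left h0, max_eq_right (by linarith)]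
  simp

theorem ramp_of_ge (hδ : 0 < δ) {s : ℝ} (h1 : δ ≤ s) : ramp δ s = s - δ / 2 := by
  rw [ramp, max_eq_left (by linarith), max_eq_left (by linarith)]
  field_simp
  ring

theorem abs_sub_ramp_le (hδ : 0 < δ) {s : ℝ} (hs : 0 ≤ s) : |s - ramp δ s| ≤ δ := by
  rcases le_total s δ with h | h
  · rw [ramp_of_mem hs h, abs_le]
    have h1 : s ^ 2 / (2 * δ) ≤ s := by
      rw [div_le_iff₀ (by positivity)]
      nlinarith
    have h2 : 0 ≤ s ^ 2 / (2 * δ) := by positivity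
    constructor <;> linarith
  · rw [ramp_of_ge hδ h, abs_le]
    constructor <;> linarith

/-- The ramp has slope in [0,1]. Only steps of length δ are needed: they form the slices in
`divPairing_le_add`. -/
theorem ramp_sub_nonneg_le (hδ : 0 < δ) (s : ℝ) :
    0 ≤ ramp δ s - ramp δ (s - δ) ∧ ramp δ s - ramp δ (s - δ) ≤ δ := by
  rcases le_total s 0 with h | h
  · rw [ramp_of_nonpos hδ h, ramp_of_nonpos hδ (by linarith)]
    simp [hδ.le]
  rcases le_total s δ with h1 | h1
  · rw [ramp_of_mem h h1, ramp_of_nonpos hδ (by linarith), sub_zero]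
    refine ⟨by positivity, ?_⟩
    rw [div_le_iff₀ (by positivity)]
    nlinarith
  rcases le_total s (2 * δ) with h2 | h2
  · rw [ramp_of_ge hδ h1, ramp_of_mem (by linarith) (by linarith)]
    have h3 : (s - δ) ^ 2 / (2 * δ) = (s - δ) * ((s - δ) / (2 * δ)) := by ring
    have h4 : (s - δ) / (2 * δ) ≤ 1 / 2 := by
      rw [div_le_iff₀ (by positivity)]
      linarith
    have h5 : s - δ / 2 - (s - δ) ^ 2 / (2 * δ) =
        δ - (2 * δ - s) ^ 2 / (2 * δ) := by
      field_simp
      ring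
    constructor
    · rw [h3]
      nlinarith
    · rw [h5]
      have : 0 ≤ (2 * δ - s) ^ 2 / (2 * δ) := by positivity
      linarith
  · rw [ramp_of_ge hδ h1, ramp_of_ge hδ (by linarith)]
    constructor <;> linarith

end Ramp

namespace StratifiedGroup

/-! ### The pairing is bounded by the L¹ norm of the variation measure -/

section Polar

variable {G : Type*} [NormedAddCommGroup G] [InnerProductSpace ℝ G] [Group G]
  [FiniteDimensional ℝ G] [MeasurableSpace G] [BorelSpace G]
  {S : StratifiedGroup G} {Ω : Set G} {f : G → ℝ}

theorem IsBVHLoc.divPairing_sum (hf : S.IsBVHLoc Ω f) (hΩ : IsOpen Ω) {φ : ℕ → G → S.Hor}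
    (hφ : ∀ k, S.IsTestField Ω (φ k)) (N : ℕ) :
    S.IsTestField Ω (∑ k ∈ Finset.range N, φ k) ∧
      S.divPairing f (∑ k ∈ Finset.range N, φ k) =
        ∑ k ∈ Finset.range N, S.divPairing f (φ k) := by
  induction N with
  | zero => simpa using ⟨S.isTestField_zero Ω, S.divPairing_zero f⟩
  | succ N ih =>
    rw [Finset.sum_range_succ, Finset.sum_range_succ]
    exact ⟨ih.1.add (hφ N), by rw [hf.divPairing_add hΩ ih.1 (hφ N), ih.2]⟩

/-- Up to an error controlled by `δ`, a test field is paired with the measure of its superlevel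
sets. -/
theorem IsBVHLoc.divPairing_le_add (hf : S.IsBVHLoc Ω f) (hΩ : IsOpen Ω) {γ : Measure G}
    [IsFiniteMeasure γ] (hγ : ∀ U : Set G, IsOpen U → U ⊆ Ω → γ U = S.hVariation f U)
    {φ : G → S.Hor} (hφ : S.IsTestField Ω φ) {δ : ℝ} (hδ : 0 < δ) :
    S.divPairing f φ ≤ ∫ x, ‖φ x‖ ∂γ + 4 * δ * γ.real Set.univ := by
  have hpair : ∀ (U : Set G) (ψ : G → S.Hor), IsOpen U → U ⊆ Ω → S.IsTestField U ψ →
      ∀ c, 0 < c → (∀ x, ‖ψ x‖ ≤ c) → S.divPairing f ψ ≤ c * γ.real U := by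
    intro U ψ hU hUΩ hψ c hc h
    have := divPairing_le_mul (f := f) hψ hc h (by rw [← hγ U hU hUΩ]; exact measure_ne_top _ _)
    rwa [← hγ U hU hUΩ] at this
  have hΩle : γ.real Ω ≤ γ.real Set.univ := measureReal_mono (Set.subset_univ _)
  -- A regularised |φ|, positive and C¹: w = φ/s is then a test field with |w| ≤ 1, and g = s − δ
  -- satisfies 0 ≤ g ≤ |φ|.
  set s : G → ℝ := fun x => Real.sqrt (‖φ x‖ ^ 2 + δ ^ 2) with hs
  have hrad : ∀ x, 0 < ‖φ x‖ ^ 2 + δ ^ 2 := fun x => by positivity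
  have hs_cd : ContDiff ℝ 1 s :=
    (((contDiff_norm_sq ℝ).comp hφ.1).add contDiff_const).sqrt fun x => (hrad x).ne'
  have hs_pos : ∀ x, 0 < s x := fun x => Real.sqrt_pos.2 (hrad x)
  have hδs : ∀ x, δ ≤ s x := fun x => Real.le_sqrt_of_sq_le (by nlinarith [sq_nonneg ‖φ x‖])
  have hφs : ∀ x, ‖φ x‖ ≤ s x := fun x => Real.le_sqrt_of_sq_le (by nlinarith [sq_nonneg δ])
  have hsle : ∀ x, s x ≤ ‖φ x‖ + δ := fun x =>
    (Real.sqrt_le_left (by positivity)).2 (by nlinarith [norm_nonneg (φ x)])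
  set g : G → ℝ := fun x => s x - δ with hg
  have hg_cd : ContDiff ℝ 1 g := hs_cd.sub contDiff_const
  have hg0 : ∀ x, 0 ≤ g x := fun x => by simpa [hg] using hδs x
  have hgφ : ∀ x, g x ≤ ‖φ x‖ := fun x => by simpa [hg] using hsle x
  set w : G → S.Hor := fun x => (s x)⁻¹ • φ x with hw
  have hw_t : S.IsTestField Ω w := hφ.mul (hs_cd.inv fun x => (hs_pos x).ne')
  have hw1 : ∀ x, ‖w x‖ ≤ 1 := fun x => by
    rw [hw, norm_smul, norm_inv, Real.norm_of_nonneg (hs_pos x).le, inv_mul_le_iff₀ (hs_pos x),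
      mul_one]
    exact hφs x
  have hmulw : ∀ (u : ℝ) x, ‖u • w x‖ ≤ |u| := fun u x => by
    rw [norm_smul, Real.norm_eq_abs]
    exact mul_le_of_le_one_right (abs_nonneg _) (hw1 x)
  obtain ⟨M, hM⟩ : ∃ M, ∀ x, ‖φ x‖ ≤ M := hφ.2.1.exists_bound_of_continuous hφ.1.continuous
  obtain ⟨N, hN⟩ := exists_nat_ge (M / δ)
  have hMN : M ≤ N * δ := by rwa [div_le_iff₀ hδ] at hN
  -- Slices of height at most δ. They telescope to `ramp δ (g x)`, since g ≤ Nδ makes the last ramp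
  -- vanish.
  set T : ℕ → ℝ → ℝ := fun k r => ramp δ (r - k * δ) - ramp δ (r - (k + 1 : ℕ) * δ) with hT
  have hT_cd : ∀ k, ContDiff ℝ 1 (T k) := fun k =>
    ((contDiff_ramp δ).comp (contDiff_id.sub contDiff_const)).sub
      ((contDiff_ramp δ).comp (contDiff_id.sub contDiff_const))
  have hT_le : ∀ k r, |T k r| ≤ δ := fun k r => by
    have := ramp_sub_nonneg_le hδ (r - k * δ)
    have e : r - k * δ - δ = r - (k + 1 : ℕ) * δ := by
      push_cast
      ring
    rw [e] at this
    rw [hT, abs_of_nonneg this.1]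
    exact this.2
  have hT_zero : ∀ (k : ℕ) (r : ℝ), r ≤ k * δ → T k r = 0 := fun k r h => by
    rw [hT]
    simp only
    rw [ramp_of_nonpos hδ (by linarith), ramp_of_nonpos hδ (by push_cast; linarith), sub_zero]
  have hT_sum : ∀ x, ∑ k ∈ Finset.range N, T k (g x) = ramp δ (g x) := fun x => by
    rw [hT, Finset.sum_range_sub' (fun k : ℕ => ramp δ (g x - k * δ)),
      ramp_of_nonpos hδ (s := g x - N * δ)]
    · simp
    · linarith [hgφ x, hM x]
  have ht1 : S.IsTestField Ω (δ • w) := hw_t.smul δ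
  have ht2 : S.IsTestField Ω (fun x => (g x - ramp δ (g x)) • w x) :=
    hw_t.mul (hg_cd.sub ((contDiff_ramp δ).comp hg_cd))
  have ht3 : ∀ k, S.IsTestField Ω (fun x => T k (g x) • w x) := fun k =>
    hw_t.mul ((hT_cd k).comp hg_cd)
  have hsum := hf.divPairing_sum hΩ ht3 N
  -- This is s = δ + (g − ramp g) + ramp g multiplied by w. The first two fields are bounded by δ;
  -- the third is the sum of the slices.
  have hdecomp : φ = (δ • w + fun x => (g x - ramp δ (g x)) • w x) +
      ∑ k ∈ Finset.range N, fun x => T k (g x) • w x := by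
    funext x
    rw [Pi.add_apply, Pi.add_apply, Finset.sum_apply, Pi.smul_apply, ← Finset.sum_smul, hT_sum,
      ← add_smul, ← add_smul, hw, smul_smul]
    have : (δ + (g x - ramp δ (g x)) + ramp δ (g x)) * (s x)⁻¹ = 1 := by
      rw [show δ + (g x - ramp δ (g x)) + ramp δ (g x) = s x by simp only [hg]; ring,
        mul_inv_cancel₀ (hs_pos x).ne']
    rw [this, one_smul]
  -- The closed support of the k-th slice lies in {g ≥ kδ}; lowering the threshold by δ gives an
  -- open set that contains it.
  set U : ℕ → Set G := fun k => Ω ∩ {x | (k - 1 : ℝ) * δ < g x} with hUdef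
  have hUo : ∀ k, IsOpen (U k) := fun k =>
    hΩ.inter (isOpen_lt continuous_const hg_cd.continuous)
  have hTk : ∀ k, S.divPairing f (fun x => T k (g x) • w x) ≤ δ * γ.real (U k) := by
    intro k
    refine hpair (U k) _ (hUo k) Set.inter_subset_left ⟨(ht3 k).1, (ht3 k).2.1, ?_⟩ δ hδ
      fun x => (hmulw _ x).trans (hT_le k _)
    refine Set.subset_inter (ht3 k).2.2 ?_
    have hsub : tsupport (fun x => T k (g x) • w x) ⊆ {x | (k : ℝ) * δ ≤ g x} := by
      refine closure_minimal (fun x hx => ?_)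
        (isClosed_le continuous_const hg_cd.continuous)
      by_contra hlt
      refine hx ?_
      change T k (g x) • w x = 0
      rw [hT_zero k _ (not_le.1 hlt).le, zero_smul]
    intro x hx
    have : (k : ℝ) * δ ≤ g x := hsub hx
    change (k - 1 : ℝ) * δ < g x
    linarith
  have hlayer : ∑ k ∈ Finset.range N, δ * γ.real (U k) ≤ ∫ x, (‖φ x‖ + 2 * δ) ∂γ := by
    have hi : ∀ k, Integrable (fun x => (U k).indicator (fun _ => δ) x) γ := fun k =>
      (integrable_const δ).indicator (hUo k).measurableSet
    have e : ∑ k ∈ Finset.range N, δ * γ.real (U k) =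
        ∫ x, ∑ k ∈ Finset.range N, (U k).indicator (fun _ => δ) x ∂γ := by
      rw [integral_finsetSum _ fun k _ => hi k]
      refine Finset.sum_congr rfl fun k _ => ?_
      rw [integral_indicator (hUo k).measurableSet, setIntegral_const, smul_eq_mul, mul_comm]
    rw [e]
    have hφi : Integrable (fun x => ‖φ x‖) γ :=
      (hφ.1.continuous.integrable_of_hasCompactSupport hφ.2.1).norm
    refine integral_mono (integrable_finsetSum _ fun k _ => hi k)
      (hφi.add (integrable_const _)) fun x => ?_
    -- Where g > (k − 1)δ, both maxima equal their first entry and differ by exactly δ. The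
    -- telescoped sum is at most g + 2δ; with δ from each of the two remainder fields this makes the
    -- error 4δ.
    have hpt : ∀ k : ℕ, (U k).indicator (fun _ => δ) x ≤
        max (g x - ((k : ℝ) - 2) * δ) 0 - max (g x - (((k + 1 : ℕ) : ℝ) - 2) * δ) 0 := by
      intro k
      by_cases hx : x ∈ U k
      · rw [Set.indicator_of_mem hx]
        have hx2 : (k - 1 : ℝ) * δ < g x := hx.2
        rw [max_eq_left (by linarith), max_eq_left (by push_cast; linarith)]
        push_cast
        linarith
      · rw [Set.indicator_of_notMem hx, sub_nonneg]
        refine max_le_max ?_ le_rfl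
        push_cast
        linarith
    refine (Finset.sum_le_sum fun k _ => hpt k).trans ?_
    rw [Finset.sum_range_sub' (fun k : ℕ => max (g x - ((k : ℝ) - 2) * δ) 0)]
    have h1 : max (g x - (((0 : ℕ) : ℝ) - 2) * δ) 0 = g x + 2 * δ := by
      rw [max_eq_left]
      · push_cast
        ring
      · push_cast
        nlinarith [hg0 x]
    have h2 : 0 ≤ max (g x - ((N : ℝ) - 2) * δ) 0 := le_max_right _ _
    change _ ≤ ‖φ x‖ + 2 * δ
    rw [h1]
    linarith [hgφ x]
  have hint : ∫ x, (‖φ x‖ + 2 * δ) ∂γ = ∫ x, ‖φ x‖ ∂γ + 2 * δ * γ.real Set.univ := by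
    rw [integral_add (hφ.1.continuous.integrable_of_hasCompactSupport hφ.2.1).norm
      (integrable_const _), integral_const, smul_eq_mul, mul_comm (γ.real _)]
  have e1 := hpair Ω _ hΩ subset_rfl ht1 δ hδ fun x =>
    (hmulw δ x).trans_eq (abs_of_pos hδ)
  have e2 := hpair Ω _ hΩ subset_rfl ht2 δ hδ fun x =>
    (hmulw _ x).trans (abs_sub_ramp_le hδ (hg0 x))
  have e3 : ∑ k ∈ Finset.range N, S.divPairing f (fun x => T k (g x) • w x) ≤
      ∑ k ∈ Finset.range N, δ * γ.real (U k) := Finset.sum_le_sum fun k _ => hTk k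
  have e4 : δ * γ.real Ω ≤ δ * γ.real Set.univ := mul_le_mul_of_nonneg_left hΩle hδ.le
  have e5 : S.divPairing f φ = S.divPairing f (δ • w) +
      S.divPairing f (fun x => (g x - ramp δ (g x)) • w x) +
      ∑ k ∈ Finset.range N, S.divPairing f (fun x => T k (g x) • w x) := by
    rw [← hsum.2, ← hf.divPairing_add hΩ ht1 ht2, ← hf.divPairing_add hΩ (ht1.add ht2) hsum.1,
      ← hdecomp]
  linarith

/-- Let δ → 0 in `divPairing_le_add`, for φ and for −φ. -/
theorem IsBVHLoc.abs_divPairing_le (hf : S.IsBVHLoc Ω f) (hΩ : IsOpen Ω) {γ : Measure G}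
    [IsFiniteMeasure γ] (hγ : ∀ U : Set G, IsOpen U → U ⊆ Ω → γ U = S.hVariation f U)
    {φ : G → S.Hor} (hφ : S.IsTestField Ω φ) : |S.divPairing f φ| ≤ ∫ x, ‖φ x‖ ∂γ := by
  have key : ∀ ψ : G → S.Hor, S.IsTestField Ω ψ → S.divPairing f ψ ≤ ∫ x, ‖ψ x‖ ∂γ := by
    intro ψ hψ
    have hlim : Tendsto (fun δ : ℝ => ∫ x, ‖ψ x‖ ∂γ + 4 * δ * γ.real Set.univ) (𝓝[>] 0)
        (𝓝 (∫ x, ‖ψ x‖ ∂γ)) := by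
      have hc : Continuous fun δ : ℝ => ∫ x, ‖ψ x‖ ∂γ + 4 * δ * γ.real Set.univ := by fun_prop
      have := hc.tendsto 0
      simp only [mul_zero, zero_mul, add_zero] at this
      exact this.mono_left nhdsWithin_le_nhds
    refine ge_of_tendsto hlim ?_
    filter_upwards [self_mem_nhdsWithin] with δ hδ
    exact hf.divPairing_le_add hΩ hγ hψ hδ
  refine abs_le'.2 ⟨key φ hφ, ?_⟩
  have := key _ (hφ.smul (-1))
  rw [divPairing_smul] at this
  simpa using this

end Polar

end StratifiedGroup

/-- A linear functional that is bounded by the norm of a linear map into a Hilbert space is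
represented by a vector of the Hilbert space, with the same bound. -/
theorem exists_inner_eq_of_le_norm {E H : Type*} [AddCommGroup E] [Module ℝ E]
    [NormedAddCommGroup H] [InnerProductSpace ℝ H] [CompleteSpace H] (T : E →ₗ[ℝ] H)
    (L : E →ₗ[ℝ] ℝ) {C : ℝ} (hC : 0 ≤ C) (h : ∀ φ, |L φ| ≤ C * ‖T φ‖) :
    ∃ v : H, ‖v‖ ≤ C ∧ ∀ φ, L φ = inner ℝ v (T φ) := by
  -- A linear section of `T` transports `L` to the range of `T`. The choice does not matter, since
  -- the bound makes `L` vanish on the kernel of `T`. Hahn-Banach and Riesz do the rest.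
  obtain ⟨g, hg⟩ := T.rangeRestrict.exists_rightInverse_of_surjective T.range_rangeRestrict
  have hTg : ∀ y : LinearMap.range T, T (g y) = y := fun y =>
    congrArg Subtype.val (LinearMap.congr_fun hg y)
  let l : StrongDual ℝ (LinearMap.range T) := (L ∘ₗ g).mkContinuous C fun y => by
    simpa [hTg] using h (g y)
  obtain ⟨k, hk, hkn⟩ := exists_extension_norm_eq (LinearMap.range T) l
  refine ⟨(InnerProductSpace.toDual ℝ H).symm k, ?_, fun φ => ?_⟩
  · rw [LinearIsometryEquiv.norm_map, hkn]
    exact LinearMap.mkContinuous_norm_le _ hC _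
  · rw [InnerProductSpace.toDual_symm_apply]
    have h1 : k (T φ) = L (g ⟨T φ, φ, rfl⟩) := hk ⟨T φ, φ, rfl⟩
    have h2 := h (φ - g ⟨T φ, φ, rfl⟩)
    rw [map_sub, map_sub, hTg, sub_self, norm_zero, mul_zero] at h2
    rw [h1]
    exact sub_eq_zero.1 (abs_eq_zero.1 (le_antisymm h2 (abs_nonneg _)))

namespace StratifiedGroup

/-! ### Polar decomposition of the distributional gradient -/

section Polar

variable {G : Type*} [NormedAddCommGroup G] [InnerProductSpace ℝ G] [Group G]
  [FiniteDimensional ℝ G] [MeasurableSpace G] [BorelSpace G]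
  {S : StratifiedGroup G} {Ω : Set G} {f : G → ℝ}

/-- The linear space of test fields. -/
def testFields (S : StratifiedGroup G) (Ω : Set G) : Submodule ℝ (G → S.Hor) where
  carrier := {φ | S.IsTestField Ω φ}
  add_mem' h1 h2 := IsTestField.add h1 h2
  zero_mem' := S.isTestField_zero Ω
  smul_mem' c _ h := IsTestField.smul h c

theorem IsTestField.memLp {φ : G → S.Hor} (hφ : S.IsTestField Ω φ) (γ : Measure G)
    [IsFiniteMeasure γ] (p : ENNReal) : MemLp φ p γ :=
  hφ.1.continuous.memLp_of_hasCompactSupport hφ.2.1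

/-- Polar decomposition of the distributional horizontal gradient. -/
theorem IsBVHLoc.exists_isHorGradMeasure (hf : S.IsBVHLoc Ω f) (hΩ : IsOpen Ω)
    (hfΩ : S.hVariation f Ω < ⊤) :
    ∃ (γ : Measure G) (σ : G → S.Hor), S.IsHorGradMeasure Ω f γ σ := by
  obtain ⟨γ, hγ0, hγ⟩ := hf.exists_variation_measure hΩ hfΩ
  have hγuniv : γ Set.univ = γ Ω := by
    refine le_antisymm ?_ (measure_mono (Set.subset_univ _))
    calc γ Set.univ = γ (Ω ∪ Ωᶜ) := by rw [Set.union_compl_self]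
      _ ≤ γ Ω + γ Ωᶜ := measure_union_le _ _
      _ = γ Ω := by rw [hγ0, add_zero]
  have : IsFiniteMeasure γ := ⟨by rwa [hγuniv, hγ Ω hΩ subset_rfl]⟩
  have hrestr : γ.restrict Ω = γ :=
    Measure.restrict_eq_self_of_ae_mem (by rw [ae_iff]; exact hγ0)
  set c := γ.real Set.univ with hc
  have hc0 : 0 ≤ c := measureReal_nonneg
  let L : S.testFields Ω →ₗ[ℝ] ℝ :=
    { toFun := fun φ => S.divPairing f φ
      map_add' := fun φ ψ => hf.divPairing_add hΩ φ.2 ψ.2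
      map_smul' := fun a φ => S.divPairing_smul f φ a }
  let T : S.testFields Ω →ₗ[ℝ] Lp S.Hor 2 γ :=
    { toFun := fun φ => (IsTestField.memLp φ.2 γ 2).toLp φ
      map_add' := fun φ ψ => MemLp.toLp_add _ _
      map_smul' := fun a φ => MemLp.toLp_const_smul a _ }
  -- Hölder on the finite measure γ turns the L¹ bound into an L² bound with constant γ(G)^{1/2}.
  have hbound : ∀ φ, |L φ| ≤ Real.sqrt c * ‖T φ‖ := by
    intro φ
    have hφ : S.IsTestField Ω (φ : G → S.Hor) := φ.2
    refine (hf.abs_divPairing_le hΩ hγ hφ).trans ?_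
    have h1 : ∫ x, ‖(φ : G → S.Hor) x‖ ∂γ = (eLpNorm (φ : G → S.Hor) 1 γ).toReal := by
      rw [eLpNorm_one_eq_lintegral_enorm, integral_norm_eq_lintegral_enorm
        (hφ.memLp γ 1).aestronglyMeasurable]
    have h2 : ‖T φ‖ = (eLpNorm (φ : G → S.Hor) 2 γ).toReal :=
      Lp.norm_toLp _ (hφ.memLp γ 2)
    have h3 := eLpNorm_le_eLpNorm_mul_rpow_measure_univ (μ := γ) (p := 1) (q := 2) (by norm_num)
      (hφ.memLp γ 1).aestronglyMeasurable
    have h4 : (γ Set.univ ^ (1 / (1 : ENNReal).toReal - 1 / (2 : ENNReal).toReal)).toReal =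
        Real.sqrt c := by
      rw [← ENNReal.toReal_rpow, Real.sqrt_eq_rpow]
      congr 1
      norm_num
    rw [h1, h2, ← h4, mul_comm, ← ENNReal.toReal_mul]
    refine ENNReal.toReal_mono (ENNReal.mul_ne_top (hφ.memLp γ 2).2.ne ?_) h3
    exact ENNReal.rpow_ne_top_of_nonneg (by norm_num) (measure_ne_top _ _)
  obtain ⟨v, hv, hLv⟩ := exists_inner_eq_of_le_norm T L (Real.sqrt_nonneg c) hbound
  have hL : ∀ φ : G → S.Hor, S.IsTestField Ω φ →
      S.divPairing f φ = ∫ x, inner ℝ (v x) (φ x) ∂γ := by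
    intro φ hφ
    have h1 := hLv ⟨φ, hφ⟩
    rw [L2.inner_def] at h1
    refine Eq.trans (show S.divPairing f φ = L ⟨φ, hφ⟩ from rfl) (h1.trans ?_)
    refine integral_congr_ae ?_
    filter_upwards [MemLp.coeFn_toLp (hφ.memLp γ 2)] with x hx
    exact congrArg (inner ℝ (v x)) hx
  have hvsq : Integrable (fun x => ‖v x‖ ^ 2) γ := (Lp.memLp v).integrable_norm_pow two_ne_zero
  have hv1 : Integrable (fun x => ‖v x‖) γ :=
    ((Lp.memLp v).integrable (by norm_num)).norm
  have hsq : ∫ x, ‖v x‖ ^ 2 ∂γ ≤ c := by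
    have h1 : ∫ x, ‖v x‖ ^ 2 ∂γ = ‖v‖ ^ 2 := by
      rw [← real_inner_self_eq_norm_sq, L2.inner_def]
      simp only [real_inner_self_eq_norm_sq]
    rw [h1, ← Real.sq_sqrt hc0]
    exact pow_le_pow_left₀ (norm_nonneg _) hv 2
  -- The total mass is a supremum of pairings with fields bounded by one, each at most ∫ |v|.
  have hlow : c ≤ ∫ x, ‖v x‖ ∂γ := by
    have h1 : S.hVariation f Ω ≤ ENNReal.ofReal (∫ x, ‖v x‖ ∂γ) := by
      refine hVariation_le fun φ hφ hφ1 => ENNReal.ofReal_le_ofReal ?_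
      rw [hL φ hφ]
      refine (Real.le_norm_self _).trans ((norm_integral_le_integral_norm _).trans ?_)
      refine integral_mono_of_nonneg (.of_forall fun x => norm_nonneg _) hv1
        (.of_forall fun x => ?_)
      exact (norm_inner_le_norm _ _).trans (mul_le_of_le_one_right (norm_nonneg _) (hφ1 x))
    rw [← hγ Ω hΩ subset_rfl, ← hγuniv] at h1
    exact ENNReal.toReal_le_of_le_ofReal (integral_nonneg fun x => norm_nonneg _) h1
  -- ∫ (|v| − 1)² = ∫ |v|² − 2∫ |v| + c ≤ c − 2c + c = 0.
  have hnorm : ∀ᵐ x ∂γ, ‖v x‖ = 1 := by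
    have e : (fun x => (‖v x‖ - 1) ^ 2) = fun x => ‖v x‖ ^ 2 - 2 * ‖v x‖ + 1 := by
      funext x
      ring
    have hdiff : Integrable (fun x => ‖v x‖ ^ 2 - 2 * ‖v x‖) γ := hvsq.sub (hv1.const_mul 2)
    have hint : Integrable (fun x => (‖v x‖ - 1) ^ 2) γ := by
      rw [e]
      exact hdiff.add (integrable_const 1)
    have h0 : ∫ x, (‖v x‖ - 1) ^ 2 ∂γ = 0 := by
      refine le_antisymm ?_ (integral_nonneg fun x => sq_nonneg _)
      have : ∫ x, (‖v x‖ - 1) ^ 2 ∂γ = ∫ x, ‖v x‖ ^ 2 ∂γ - 2 * ∫ x, ‖v x‖ ∂γ + c := by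
        rw [e, integral_add hdiff (integrable_const 1),
          integral_sub hvsq (hv1.const_mul 2), integral_const_mul, integral_const]
        simp [hc]
      rw [this]
      linarith
    rw [integral_eq_zero_iff_of_nonneg (fun x => sq_nonneg _) hint] at h0
    filter_upwards [h0] with x hx
    have : ‖v x‖ - 1 = 0 := by simpa using hx
    linarith
  refine ⟨γ, fun x => -v x, hγ0, hγ, (Lp.aestronglyMeasurable v).neg, ?_, fun φ hφ => ?_⟩
  · filter_upwards [hnorm] with x hx
    rw [norm_neg, hx]
  · rw [S.setIntegral_eq_divPairing f hφ.2.2, hL φ hφ, hrestr, ← integral_neg]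
    refine integral_congr_ae (.of_forall fun x => ?_)
    simp only [inner_neg_right, neg_neg]
    exact real_inner_comm _ _

end Polar

end StratifiedGroup

/-- A continuous function with compact support in an open set is the uniform limit of `C¹`
functions supported in a common compact subset of that open set. -/
theorem exists_contDiff_approx_of_tsupport_subset {E : Type*} [NormedAddCommGroup E]
    [NormedSpace ℝ E] [FiniteDimensional ℝ E] {κ : E → ℝ} (hκ : Continuous κ)
    (hc : HasCompactSupport κ) {W : Set E} (hW : IsOpen W) (hκW : tsupport κ ⊆ W) :
    ∃ K : Set E, IsCompact K ∧ K ⊆ W ∧ tsupport κ ⊆ K ∧ ∀ δ > 0, ∃ g : E → ℝ,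
      ContDiff ℝ 1 g ∧ tsupport g ⊆ K ∧ ∀ x, |g x - κ x| ≤ δ := by
  obtain ⟨V, hV, hκV, hVW, hVc⟩ := exists_open_between_and_isCompact_closure hc hW hκW
  obtain ⟨u, hu, hur, hus, hu1⟩ := exists_contMDiff_support_eq_eq_one_iff
    (n := (1 : ℕ∞)) (modelWithCornersSelf ℝ E) hV (isClosed_tsupport κ) hκV
  have hu01 : ∀ x, 0 ≤ u x ∧ u x ≤ 1 := fun x => hur ⟨x, rfl⟩
  refine ⟨closure V, hVc, hVW, hκV.trans subset_closure, fun δ hδ => ?_⟩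
  obtain ⟨g, hg, hgκ⟩ :=
    (hc.uniformContinuous_of_continuous hκ).exists_contDiff_dist_le hδ
  -- The cutoff equals 1 on the support of κ, so multiplying by it leaves κ unchanged and does not
  -- increase the error.
  refine ⟨fun x => u x * g x, hu.contDiff.mul (hg.of_le (by exact_mod_cast le_top)),
    closure_mono fun x hx => ?_, fun x => ?_⟩
  · rw [← hus]
    exact left_ne_zero_of_mul hx
  · have h1 : u x * κ x = κ x := by
      by_cases hx : x ∈ tsupport κ
      · rw [(hu1 x).1 hx, one_mul]
      · rw [image_eq_zero_of_notMem_tsupport hx, mul_zero]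
    have h2 := (hgκ x).le
    rw [Real.dist_eq] at h2
    calc |u x * g x - κ x| = u x * |g x - κ x| := by
          nth_rewrite 1 [← h1]
          rw [← mul_sub, abs_mul, abs_of_nonneg (hu01 x).1]
      _ ≤ 1 * δ := mul_le_mul (hu01 x).2 h2 (abs_nonneg _) zero_le_one
      _ = δ := one_mul δ

namespace StratifiedGroup

/-! ### Supports of convolution kernels -/

section Kernel

variable {G : Type*} [NormedAddCommGroup G] [InnerProductSpace ℝ G] [Group G]

theorem inv_smul_eq (S : StratifiedGroup G) (t : ℝ) (v : G) : (t • v)⁻¹ = (-t) • v := by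
  rw [S.inv_eq_neg, neg_smul]

theorem horDiv_single (S : StratifiedGroup G) (j : S.HorIdx) (ψ : G → ℝ) (y : G) :
    S.horDiv (fun y => EuclideanSpace.single j (ψ y)) y = S.leftDeriv j ψ y := by
  rw [horDiv, Finset.sum_eq_single_of_mem j (Finset.mem_univ j)]
  · simp
  · intro i _ hij
    have : (fun y => (EuclideanSpace.single j (ψ y) : S.Hor) i) = fun _ => 0 := by
      funext y
      simp [hij]
    rw [this, leftDeriv, deriv_const]

/-- The points `y` at which some kernel `y ↦ k (x y⁻¹)`, with `k` supported in `K` and `x ∈ C`, may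
not vanish. -/
def kernelSupport {G : Type*} [Group G] (K C : Set G) : Set G :=
  (fun p : G × G => p.1⁻¹ * p.2) '' (K ×ˢ C)

theorem isCompact_kernelSupport [FiniteDimensional ℝ G] (S : StratifiedGroup G) {K C : Set G} (hK : IsCompact K)
    (hC : IsCompact C) : IsCompact (kernelSupport K C) :=
  (hK.prod hC).image S.continuous_inv_mul

theorem eq_zero_of_notMem_kernelSupport {G : Type*} [NormedAddCommGroup G] [Group G] {K C : Set G} {k : G → ℝ} (hk : tsupport k ⊆ K) {x y : G}
    (hx : x ∈ C) (hy : y ∉ kernelSupport K C) : k (x * y⁻¹) = 0 := by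
  refine image_eq_zero_of_notMem_tsupport fun h => hy ?_
  exact ⟨(x * y⁻¹, x), ⟨hk h, hx⟩, by simp⟩

end Kernel

/-! ### Differentiating the mollification -/

section Mollify

variable {G : Type*} [NormedAddCommGroup G] [InnerProductSpace ℝ G] [Group G]
  [FiniteDimensional ℝ G] [MeasurableSpace G] [BorelSpace G]
  {S : StratifiedGroup G} {Ω : Set G} {f : G → ℝ} {γ : Measure G} {σ : G → S.Hor}

theorem IsHorGradMeasure.isFiniteMeasure (h : S.IsHorGradMeasure Ω f γ σ) (hΩ : IsOpen Ω)
    (hfΩ : S.hVariation f Ω < ⊤) : IsFiniteMeasure γ := by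
  refine ⟨lt_of_le_of_lt ?_ hfΩ⟩
  calc γ Set.univ = γ (Ω ∪ Ωᶜ) := by rw [Set.union_compl_self]
    _ ≤ γ Ω + γ Ωᶜ := measure_union_le _ _
    _ = S.hVariation f Ω := by rw [h.concentrated, add_zero, h.apply_open Ω hΩ subset_rfl]

theorem IsHorGradMeasure.restrict_eq (h : S.IsHorGradMeasure Ω f γ σ) : γ.restrict Ω = γ :=
  Measure.restrict_eq_self_of_ae_mem (by rw [ae_iff]; exact h.concentrated)

theorem IsHorGradMeasure.integrable [IsFiniteMeasure γ] (h : S.IsHorGradMeasure Ω f γ σ) :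
    Integrable σ γ :=
  (integrable_const (1 : ℝ)).mono' h.aestronglyMeasurable (h.norm_eq_one.mono fun _ hx => hx.le)

theorem IsHorGradMeasure.integrable_component [IsFiniteMeasure γ]
    (h : S.IsHorGradMeasure Ω f γ σ) (j : S.HorIdx) : Integrable (fun y => σ y j) γ :=
  (EuclideanSpace.proj (𝕜 := ℝ) j).integrable_comp h.integrable

theorem integrable_kernel_mul (S : StratifiedGroup G) {k : G → ℝ} (hk : Continuous k)
    (hkc : HasCompactSupport k) {w : G → ℝ} (hw : Integrable w γ) (x : G) :
    Integrable (fun y => k (x * y⁻¹) * w y) γ := by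
  obtain ⟨M, hM⟩ := hkc.exists_bound_of_continuous hk
  exact hw.bdd_mul (hk.comp (S.continuous_mul_inv.comp
    (continuous_const.prodMk continuous_id))).aestronglyMeasurable (.of_forall fun y => hM _)

theorem continuous_integral_kernel_mul (S : StratifiedGroup G) {k : G → ℝ} (hk : Continuous k)
    (hkc : HasCompactSupport k) {w : G → ℝ} (hw : Integrable w γ) :
    Continuous fun x => ∫ y, k (x * y⁻¹) * w y ∂γ := by
  obtain ⟨M, hM⟩ := hkc.exists_bound_of_continuous hk
  refine continuous_of_dominated (bound := fun y => M * ‖w y‖)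
    (fun x => (S.integrable_kernel_mul hk hkc hw x).aestronglyMeasurable)
    (fun x => .of_forall fun y => ?_) (hw.norm.const_mul M) (.of_forall fun y => ?_)
  · rw [norm_mul]
    exact mul_le_mul_of_nonneg_right (hM _) (norm_nonneg _)
  · exact (hk.comp (S.continuous_mul_inv.comp (continuous_id.prodMk continuous_const))).mul
      continuous_const

theorem IsBVHLoc.aestronglyMeasurable (hf : S.IsBVHLoc Ω f) (hΩ : IsOpen Ω) :
    AEStronglyMeasurable f (volume.restrict Ω) := by
  have : LocallyIntegrableOn f Ω :=
    (locallyIntegrableOn_iff hΩ.isLocallyClosed).2 fun K hKΩ hK => hf.integrableOn hΩ hK hKΩ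
  exact this.aestronglyMeasurable

/-- The common majorant for differentiating under the integral and for dominated convergence; f is
only locally integrable in Ω, so the kernels must act on one compact subset. -/
theorem IsBVHLoc.integrable_indicator_kernelSupport (hf : S.IsBVHLoc Ω f) (hΩ : IsOpen Ω)
    {K C : Set G} (hK : IsCompact K) (hC : IsCompact C)
    (hKC : ∀ x ∈ C, ∀ z ∈ K, z⁻¹ * x ∈ Ω) (M : ℝ) :
    Integrable ((kernelSupport K C).indicator fun y => M * |f y|) (volume.restrict Ω) := by
  have hcomp := S.isCompact_kernelSupport hK hC
  have hsub : kernelSupport K C ⊆ Ω := by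
    rintro _ ⟨⟨z, x⟩, ⟨hz, hx⟩, rfl⟩
    exact hKC x hx z hz
  refine Integrable.mono_measure ?_ Measure.restrict_le_self
  rw [integrable_indicator_iff hcomp.measurableSet]
  exact ((hf.integrableOn hΩ hcomp hsub).abs).const_mul M

/-- Left invariant derivative of a mollification with a `C¹` kernel. -/
theorem IsHorGradMeasure.hasDerivAt_of_contDiff (h : S.IsHorGradMeasure Ω f γ σ)
    (hf : S.IsBVHLoc Ω f) (hΩ : IsOpen Ω) {k : G → ℝ} (hk : ContDiff ℝ 1 k) {K : Set G}
    (hK : IsCompact K) (hkK : tsupport k ⊆ K) {W : Set G} (hW : IsOpen W)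
    (hKW : ∀ x ∈ W, ∀ z ∈ K, z⁻¹ * x ∈ Ω) {x : G} (hx : x ∈ W) (j : S.HorIdx) :
    HasDerivAt (fun t : ℝ => ∫ y in Ω, k (x * (t • S.e j.1) * y⁻¹) * f y)
      (∫ y in Ω, k (x * y⁻¹) * σ y j ∂γ) 0 := by
  have hcurve : Continuous fun t : ℝ => x * (t • S.e j.1) :=
    S.continuous_mul'.comp (continuous_const.prodMk (continuous_id.smul continuous_const))
  have hcurve0 : x * ((0 : ℝ) • S.e j.1) = x := by rw [zero_smul, S.mul_zero']
  obtain ⟨r, hr, hrW⟩ : ∃ r > 0, ∀ t ∈ Metric.closedBall (0 : ℝ) r, x * (t • S.e j.1) ∈ W := by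
    have : (fun t : ℝ => x * (t • S.e j.1)) ⁻¹' W ∈ 𝓝 (0 : ℝ) :=
      hcurve.continuousAt.preimage_mem_nhds (by rw [hcurve0]; exact hW.mem_nhds hx)
    obtain ⟨r, hr, hsub⟩ := Metric.nhds_basis_closedBall.mem_iff.1 this
    exact ⟨r, hr, fun t ht => hsub ht⟩
  -- A compact piece of the integral curve of X_j through x. For all its points the kernels vanish
  -- outside one compact subset of Ω.
  set C : Set G := (fun t : ℝ => x * (t • S.e j.1)) '' Metric.closedBall (0 : ℝ) r with hCdef
  have hC : IsCompact C := (isCompact_closedBall _ _).image hcurve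
  have hKC : ∀ y ∈ C, ∀ z ∈ K, z⁻¹ * y ∈ Ω := by
    rintro _ ⟨t, ht, rfl⟩ z hz
    exact hKW _ (hrW t ht) z hz
  have hA := S.isCompact_kernelSupport hK hC
  set A := kernelSupport K C with hAdef
  set F : ℝ × G → ℝ := fun p => k (x * (p.1 • S.e j.1) * p.2⁻¹) with hF
  have hFcd : ContDiff ℝ 1 F := by
    refine hk.comp (S.contDiff_mul.comp (ContDiff.prodMk ?_ (S.contDiff_inv.comp contDiff_snd)))
    exact S.contDiff_mul.comp (contDiff_const.prodMk (contDiff_fst.smul contDiff_const))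
  set D : ℝ → G → ℝ := fun t y => fderiv ℝ F (t, y) (1, 0) with hD
  have hDc : Continuous fun p : ℝ × G => D p.1 p.2 :=
    (hFcd.continuous_fderiv one_ne_zero).clm_apply continuous_const
  have hFD : ∀ t y, HasDerivAt (fun s => F (s, y)) (D t y) t := by
    intro t y
    have h1 : HasDerivAt (fun s : ℝ => (s, y)) ((1 : ℝ), (0 : G)) t :=
      (hasDerivAt_id t).prodMk (hasDerivAt_const t y)
    exact (hFcd.differentiable one_ne_zero (t, y)).hasFDerivAt.comp_hasDerivAt t h1
  have hD0 : ∀ t ∈ Metric.ball (0 : ℝ) r, ∀ y ∉ A, D t y = 0 := by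
    intro t ht y hy
    refine (hFD t y).unique ((hasDerivAt_const t (0 : ℝ)).congr_of_eventuallyEq ?_)
    filter_upwards [Metric.isOpen_ball.mem_nhds ht] with s hs
    exact eq_zero_of_notMem_kernelSupport (C := C) (x := x * (s • S.e j.1)) hkK ⟨s, Metric.ball_subset_closedBall hs, rfl⟩ hy
  obtain ⟨M, hM⟩ := ((isCompact_closedBall (0 : ℝ) r).prod hA).exists_bound_of_continuousOn
    hDc.continuousOn
  have hfm := hf.aestronglyMeasurable hΩ
  have hFm : ∀ t, AEStronglyMeasurable (fun y => F (t, y) * f y) (volume.restrict Ω) := fun t =>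
    (hFcd.continuous.comp (continuous_const.prodMk continuous_id)).aestronglyMeasurable.mul hfm
  have hF0 : Integrable (fun y => F (0, y) * f y) (volume.restrict Ω) := by
    have := (hf.integrable_mul hΩ hA (K := A) (by
      rintro _ ⟨⟨z, y⟩, ⟨hz, hy⟩, rfl⟩
      exact hKC y hy z hz) (h := fun y => F (0, y))
      (hFcd.continuous.comp (continuous_const.prodMk continuous_id)) (fun y hy =>
        eq_zero_of_notMem_kernelSupport (C := C) (x := x * ((0 : ℝ) • S.e j.1)) hkK
          ⟨0, by simp [hr.le], rfl⟩ hy)).restrict (s := Ω)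
    simpa only [mul_comm] using this
  have key := hasDerivAt_integral_of_dominated_loc_of_deriv_le (μ := volume.restrict Ω)
    (F := fun t y => F (t, y) * f y) (F' := fun t y => D t y * f y) (x₀ := (0 : ℝ))
    (bound := A.indicator fun y => M * |f y|) (Metric.ball_mem_nhds (0 : ℝ) hr)
    (.of_forall hFm) hF0
    ((hDc.comp (continuous_const.prodMk continuous_id)).aestronglyMeasurable.mul hfm)
    (.of_forall fun y t ht => by
      by_cases hy : y ∈ A
      · rw [Set.indicator_of_mem hy, norm_mul]
        exact mul_le_mul_of_nonneg_right (hM (t, y) ⟨Metric.ball_subset_closedBall ht, hy⟩)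
          (norm_nonneg _)
      · rw [Set.indicator_of_notMem hy, hD0 t ht y hy, zero_mul, norm_zero])
    (hf.integrable_indicator_kernelSupport hΩ hK hC hKC M)
    (.of_forall fun y t _ => (hFD t y).mul_const (f y))
  have hψcd : ContDiff ℝ 1 fun y : G => k (x * y⁻¹) :=
    hk.comp (S.contDiff_mul.comp (contDiff_const.prodMk S.contDiff_inv))
  have hφt : S.IsTestField Ω fun y => EuclideanSpace.single j (k (x * y⁻¹)) := by
    have hAx := S.isCompact_kernelSupport hK (isCompact_singleton (x := x))
    have hsub : tsupport (fun y => (EuclideanSpace.single j (k (x * y⁻¹)) : S.Hor)) ⊆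
        kernelSupport K {x} := by
      refine closure_minimal (fun y hy => ?_) hAx.isClosed
      by_contra hyA
      refine hy ?_
      simp only
      rw [eq_zero_of_notMem_kernelSupport hkK (Set.mem_singleton x) hyA]
      simp
    refine ⟨?_, hAx.of_isClosed_subset (isClosed_tsupport _) hsub, hsub.trans ?_⟩
    · rw [contDiff_euclidean]
      intro i
      by_cases hij : i = j
      · subst hij
        simpa using hψcd
      · simpa [hij] using contDiff_const
    · rintro _ ⟨⟨z, y⟩, ⟨hz, rfl⟩, rfl⟩
      exact hKW _ hx z hz
  have hibp := h.integral_by_parts _ hφt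
  -- As (y · te_j)⁻¹ = (−t)e_j · y⁻¹, moving x along X_j amounts to moving y backwards along X_j;
  -- this sign cancels the one from integration by parts.
  have hDleft : ∀ y, D 0 y = -S.leftDeriv j (fun y => k (x * y⁻¹)) y := by
    intro y
    have e : (fun t : ℝ => k (x * (y * (t • S.e j.1))⁻¹)) = fun t => F (-t, y) := by
      funext t
      rw [hF, mul_inv_rev, S.inv_smul_eq, ← mul_assoc]
    rw [leftDeriv, e, deriv_comp_neg (f := fun s => F (s, y)), neg_zero, (hFD 0 y).deriv, neg_neg]
  have hval : ∫ y in Ω, D 0 y * f y = ∫ y in Ω, k (x * y⁻¹) * σ y j ∂γ := by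
    simp only [horDiv_single] at hibp
    have e1 : ∫ y in Ω, D 0 y * f y =
        -∫ y in Ω, f y * S.leftDeriv j (fun y => k (x * y⁻¹)) y := by
      rw [← integral_neg]
      refine integral_congr_ae (.of_forall fun y => ?_)
      simp only [hDleft]
      ring
    rw [e1, hibp, neg_neg]
    refine integral_congr_ae (.of_forall fun y => ?_)
    simp only [EuclideanSpace.inner_single_left, conj_trivial]
  rw [← hval]
  exact key.2

/-- Left invariant derivative of a mollification with a continuous kernel. -/
theorem IsHorGradMeasure.hasDerivAt_of_continuous [IsFiniteMeasure γ]
    (h : S.IsHorGradMeasure Ω f γ σ)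
    (hf : S.IsBVHLoc Ω f) (hΩ : IsOpen Ω) {k : G → ℝ} (hk : Continuous k)
    (hkc : HasCompactSupport k) {V : Set G} (hV : IsOpen V) (hkV : tsupport k ⊆ V)
    {W : Set G} (hW : IsOpen W) (hVW : ∀ x ∈ W, ∀ z ∈ V, z⁻¹ * x ∈ Ω) {x : G} (hx : x ∈ W)
    (j : S.HorIdx) :
    HasDerivAt (fun t : ℝ => ∫ y in Ω, k (x * (t • S.e j.1) * y⁻¹) * f y)
      (∫ y in Ω, k (x * y⁻¹) * σ y j ∂γ) 0 := by
  obtain ⟨K, hK, hKV, hkK, happ⟩ := exists_contDiff_approx_of_tsupport_subset hk hkc hV hkV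
  have hKW : ∀ x ∈ W, ∀ z ∈ K, z⁻¹ * x ∈ Ω := fun x hx z hz => hVW x hx z (hKV hz)
  choose g hgcd hgK hgk using fun n : ℕ => happ (1 / ((n : ℝ) + 1)) (by positivity)
  have hgc : ∀ n, HasCompactSupport (g n) := fun n =>
    hK.of_isClosed_subset (isClosed_tsupport _) (hgK n)
  have hlim0 : Tendsto (fun n : ℕ => 1 / ((n : ℝ) + 1)) atTop (𝓝 0) :=
    tendsto_one_div_add_atTop_nhds_zero_nat
  have hgpt : ∀ z, Tendsto (fun n => g n z) atTop (𝓝 (k z)) := fun z => by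
    rw [tendsto_iff_norm_sub_tendsto_zero]
    exact squeeze_zero (fun n => norm_nonneg _) (fun n => hgk n z) hlim0
  obtain ⟨M, hM⟩ := hkc.exists_bound_of_continuous hk
  have hgM : ∀ n z, ‖g n z‖ ≤ M + 1 := fun n z => by
    have h1 := hgk n z
    have h2 : 1 / ((n : ℝ) + 1) ≤ 1 := by
      rw [div_le_one (by positivity)]
      linarith [n.cast_nonneg (α := ℝ)]
    have h3 : ‖g n z‖ ≤ ‖g n z - k z‖ + ‖k z‖ := by
      simpa using norm_add_le (g n z - k z) (k z)
    rw [Real.norm_eq_abs (g n z - k z)] at h3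
    linarith [hM z]
  have hcurve : Continuous fun t : ℝ => x * (t • S.e j.1) :=
    S.continuous_mul'.comp (continuous_const.prodMk (continuous_id.smul continuous_const))
  set I : Set ℝ := (fun t : ℝ => x * (t • S.e j.1)) ⁻¹' W with hI
  have hIo : IsOpen I := hW.preimage hcurve
  have h0I : (0 : ℝ) ∈ I := by
    change x * ((0 : ℝ) • S.e j.1) ∈ W
    rwa [zero_smul, S.mul_zero']
  -- The derivative at t is the derivative at 0 with base point x · te_j, because te_j · (s − t)e_j
  -- = se_j.
  have hderiv : ∀ (n : ℕ) (t : ℝ), t ∈ I →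
      HasDerivAt (fun t : ℝ => ∫ y in Ω, g n (x * (t • S.e j.1) * y⁻¹) * f y)
        (∫ y in Ω, g n (x * (t • S.e j.1) * y⁻¹) * σ y j ∂γ) t := by
    intro n t ht
    have h1 := h.hasDerivAt_of_contDiff hf hΩ (hgcd n) hK (hgK n) hW hKW ht j
    have h2 : HasDerivAt (fun s : ℝ => s - t) 1 t := (hasDerivAt_id t).sub_const t
    rw [← sub_self t] at h1
    have h3 := HasDerivAt.scomp (h := fun s : ℝ => s - t) t h1 h2
    rw [one_smul] at h3
    refine h3.congr_of_eventuallyEq (.of_forall fun s => ?_)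
    simp only [Function.comp_apply]
    rw [mul_assoc x, S.smul_mul_smul, add_sub_cancel]
  have hσ := h.integrable_component j
  -- Uniformly in t, the derivatives differ from their limit by at most sup|g_n − k| · ∫ |σ_j| dγ;
  -- the functions themselves converge pointwise by dominated convergence.
  have hgoal := hasDerivAt_of_tendstoUniformlyOn (l := atTop) hIo
    (f := fun n (t : ℝ) => ∫ y in Ω, g n (x * (t • S.e j.1) * y⁻¹) * f y)
    (g := fun t : ℝ => ∫ y in Ω, k (x * (t • S.e j.1) * y⁻¹) * f y)
    (f' := fun n (t : ℝ) => ∫ y in Ω, g n (x * (t • S.e j.1) * y⁻¹) * σ y j ∂γ)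
    (g' := fun t : ℝ => ∫ y in Ω, k (x * (t • S.e j.1) * y⁻¹) * σ y j ∂γ)
    ?_ (.of_forall fun n t ht => hderiv n t ht) ?_ h0I
  · simpa only [zero_smul, S.mul_zero'] using hgoal
  · rw [Metric.tendstoUniformlyOn_iff]
    intro η hη
    have hlim1 : Tendsto (fun n : ℕ => 1 / ((n : ℝ) + 1) * ∫ y, ‖σ y j‖ ∂γ) atTop (𝓝 0) := by
      simpa using hlim0.mul_const (∫ y, ‖σ y j‖ ∂γ)
    filter_upwards [hlim1.eventually_lt_const hη] with n hn t _
    rw [h.restrict_eq, dist_comm, dist_eq_norm,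
      ← integral_sub (S.integrable_kernel_mul (hgcd n).continuous (hgc n) hσ _)
        (S.integrable_kernel_mul hk hkc hσ _)]
    refine lt_of_le_of_lt (norm_integral_le_of_norm_le
      (hσ.norm.const_mul (1 / ((n : ℝ) + 1))) (.of_forall fun y => ?_)) ?_
    · rw [← sub_mul, norm_mul]
      exact mul_le_mul_of_nonneg_right (hgk n _) (norm_nonneg _)
    · rwa [integral_const_mul]
  · intro t ht
    have hfm := hf.aestronglyMeasurable hΩ
    have hKC : ∀ y ∈ ({x * (t • S.e j.1)} : Set G), ∀ z ∈ K, z⁻¹ * y ∈ Ω := by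
      rintro y rfl z hz
      exact hKW _ ht z hz
    refine tendsto_integral_of_dominated_convergence
      ((kernelSupport K {x * (t • S.e j.1)}).indicator fun y => (M + 1) * |f y|)
      (fun n => ?_) (hf.integrable_indicator_kernelSupport hΩ hK isCompact_singleton hKC _)
      (fun n => .of_forall fun y => ?_) (.of_forall fun y => (hgpt _).mul_const _)
    · exact ((hgcd n).continuous.comp (S.continuous_mul_inv.comp
        (continuous_const.prodMk continuous_id))).aestronglyMeasurable.mul hfm
    · by_cases hy : y ∈ kernelSupport K {x * (t • S.e j.1)}
      · rw [Set.indicator_of_mem hy, norm_mul]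
        exact mul_le_mul_of_nonneg_right (hgM n _) (norm_nonneg _)
      · rw [Set.indicator_of_notMem hy,
          eq_zero_of_notMem_kernelSupport (hgK n) (Set.mem_singleton _) hy, zero_mul, norm_zero]

variable {d : G → G → ℝ} {ρ : G → ℝ}

theorem IsHorGradMeasure.hasDerivAt_mollify [IsFiniteMeasure γ]
    (h : S.IsHorGradMeasure Ω f γ σ) (hd : S.IsHomogeneousDist d) (hρ : IsSymmMollifier d ρ)
    (hf : S.IsBVHLoc Ω f) (hΩ : IsOpen Ω) {ε : ℝ} (hε : 0 < ε) {x : G}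
    (hx : x ∈ rightInner d Ω (2 * ε)) (j : S.HorIdx) :
    HasDerivAt (fun t : ℝ => S.mollify ρ ε Ω f (x * (t • S.e j.1)))
      (S.mollifyVecMeasure ρ ε Ω γ σ x j) 0 :=
  h.hasDerivAt_of_continuous hf hΩ (S.continuous_rescale hρ.continuous ε)
    (hasCompactSupport_rescale hρ hε)
    (isOpen_lt hd.continuous_left continuous_const)
    (fun _ hz => hd.lt_of_mem_tsupport_rescale hρ hε hz)
    (hd.isOpen_rightInner Ω (by positivity))
    (fun x hx z hz => mem_of_mem_rightInner hx (by
      have : d z 0 < ε := hz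
      linarith)) hx j

theorem IsHorGradMeasure.horGrad_mollify [IsFiniteMeasure γ]
    (h : S.IsHorGradMeasure Ω f γ σ) (hd : S.IsHomogeneousDist d) (hρ : IsSymmMollifier d ρ)
    (hf : S.IsBVHLoc Ω f) (hΩ : IsOpen Ω) {ε : ℝ} (hε : 0 < ε) {x : G}
    (hx : x ∈ rightInner d Ω (2 * ε)) :
    S.horGrad (S.mollify ρ ε Ω f) x = S.mollifyVecMeasure ρ ε Ω γ σ x := by
  ext j
  exact (h.hasDerivAt_mollify hd hρ hf hΩ hε hx j).deriv

theorem IsHorGradMeasure.isC1H_mollify [IsFiniteMeasure γ]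
    (h : S.IsHorGradMeasure Ω f γ σ) (hd : S.IsHomogeneousDist d) (hρ : IsSymmMollifier d ρ)
    (hf : S.IsBVHLoc Ω f) (hΩ : IsOpen Ω) {ε : ℝ} (hε : 0 < ε) :
    S.IsC1H (rightInner d Ω (2 * ε)) (S.mollify ρ ε Ω f) := by
  refine fun j => ⟨fun x hx => (h.hasDerivAt_mollify hd hρ hf hΩ hε hx j).differentiableAt, ?_⟩
  have hcont := S.continuous_integral_kernel_mul (S.continuous_rescale hρ.continuous ε)
    (hasCompactSupport_rescale hρ hε) (h.integrable_component j)
  refine hcont.continuousOn.congr fun x hx => ?_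
  rw [leftDeriv, (h.hasDerivAt_mollify hd hρ hf hΩ hε hx j).deriv]
  simp only [mollifyVecMeasure, h.restrict_eq]

end Mollify

/-! ### Mass bounds and weak convergence -/

section Convergence

variable {G : Type*} [NormedAddCommGroup G] [InnerProductSpace ℝ G] [Group G]
  [FiniteDimensional ℝ G] [MeasurableSpace G] [BorelSpace G]
  {S : StratifiedGroup G} {Ω : Set G} {f : G → ℝ} {γ : Measure G} {σ : G → S.Hor}
  {d : G → G → ℝ} {ρ : G → ℝ}

theorem IsSymmMollifier.integrable_rescale (hρ : IsSymmMollifier d ρ) {ε : ℝ} (hε : 0 < ε)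
    (y : G) : Integrable fun x => S.rescale ρ ε (x * y⁻¹) :=
  (S.measurePreserving_mul_right y⁻¹).integrable_comp_of_integrable
    ((S.continuous_rescale hρ.continuous ε).integrable_of_hasCompactSupport
      (hasCompactSupport_rescale hρ hε))

theorem IsSymmMollifier.integral_rescale_mul_inv (hρ : IsSymmMollifier d ρ) {ε : ℝ} (hε : 0 < ε)
    (y : G) : ∫ x, S.rescale ρ ε (x * y⁻¹) = 1 := by
  rw [S.integral_mul_inv_right, S.integral_rescale hρ.continuous hε, hρ.integral_eq_one]

theorem IsHorGradMeasure.mollifyMeasure_eq (h : S.IsHorGradMeasure Ω f γ σ) (ε : ℝ) (x : G) :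
    S.mollifyMeasure ρ ε Ω γ x = ∫ y, S.rescale ρ ε (x * y⁻¹) * 1 ∂γ := by
  simp only [mollifyMeasure, h.restrict_eq, mul_one]

theorem IsHorGradMeasure.mollifyVecMeasure_apply (h : S.IsHorGradMeasure Ω f γ σ) (ε : ℝ) (x : G)
    (j : S.HorIdx) :
    S.mollifyVecMeasure ρ ε Ω γ σ x j = ∫ y, S.rescale ρ ε (x * y⁻¹) * σ y j ∂γ := by
  simp only [mollifyVecMeasure, h.restrict_eq]

theorem IsHorGradMeasure.continuous_mollifyMeasure [IsFiniteMeasure γ]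
    (h : S.IsHorGradMeasure Ω f γ σ) (hρ : IsSymmMollifier d ρ) {ε : ℝ} (hε : 0 < ε) :
    Continuous (S.mollifyMeasure ρ ε Ω γ) := by
  simp only [funext (h.mollifyMeasure_eq (ρ := ρ) ε)]
  exact S.continuous_integral_kernel_mul (S.continuous_rescale hρ.continuous ε)
    (hasCompactSupport_rescale hρ hε) (integrable_const 1)

theorem IsHorGradMeasure.continuous_mollifyVecMeasure [IsFiniteMeasure γ]
    (h : S.IsHorGradMeasure Ω f γ σ) (hρ : IsSymmMollifier d ρ) {ε : ℝ} (hε : 0 < ε) :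
    Continuous (S.mollifyVecMeasure ρ ε Ω γ σ) := by
  refine (PiLp.continuous_toLp 2 _).comp (continuous_pi fun j => ?_)
  rw [h.restrict_eq]
  exact S.continuous_integral_kernel_mul (S.continuous_rescale hρ.continuous ε)
    (hasCompactSupport_rescale hρ hε) (h.integrable_component j)

/-- Collecting the components into one vector-valued integral lets the norm pass inside, where |σ| =
1 almost everywhere. -/
theorem IsHorGradMeasure.norm_mollifyVecMeasure_le [IsFiniteMeasure γ]
    (h : S.IsHorGradMeasure Ω f γ σ) (hρ : IsSymmMollifier d ρ) {ε : ℝ} (hε : 0 < ε) (x : G) :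
    ‖S.mollifyVecMeasure ρ ε Ω γ σ x‖ ≤ S.mollifyMeasure ρ ε Ω γ x := by
  have hkc := hasCompactSupport_rescale (S := S) hρ hε
  have hk := S.continuous_rescale hρ.continuous ε
  have hkx : Continuous fun y => S.rescale ρ ε (x * y⁻¹) :=
    (S.continuous_rescale_mul_inv hρ.continuous ε).comp (continuous_const.prodMk continuous_id)
  have hint : Integrable (fun y => S.rescale ρ ε (x * y⁻¹) • σ y) γ := by
    obtain ⟨M, hM⟩ := hkc.exists_bound_of_continuous hk
    refine (h.integrable.norm.const_mul M).mono'
      (hkx.aestronglyMeasurable.smul h.aestronglyMeasurable) (.of_forall fun y => ?_)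
    rw [norm_smul]
    exact mul_le_mul_of_nonneg_right (hM _) (norm_nonneg _)
  have hvec : S.mollifyVecMeasure ρ ε Ω γ σ x = ∫ y, S.rescale ρ ε (x * y⁻¹) • σ y ∂γ := by
    ext j
    rw [h.mollifyVecMeasure_apply]
    exact ((EuclideanSpace.proj (𝕜 := ℝ) j).integral_comp_comm hint)
  rw [hvec, mollifyMeasure, h.restrict_eq]
  refine (norm_integral_le_integral_norm _).trans_eq (integral_congr_ae ?_)
  filter_upwards [h.norm_eq_one] with y hy
  rw [norm_smul, hy, mul_one, Real.norm_of_nonneg (hρ.rescale_nonneg hε _)]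

/-- Tonelli: for each y the kernel has mass one in x. -/
theorem IsHorGradMeasure.lintegral_mollifyMeasure_le [IsFiniteMeasure γ]
    (h : S.IsHorGradMeasure Ω f γ σ) (hρ : IsSymmMollifier d ρ) {ε : ℝ} (hε : 0 < ε) (U : Set G) :
    ∫⁻ x in U, ENNReal.ofReal (S.mollifyMeasure ρ ε Ω γ x) ≤ γ Ω := by
  have hcont := S.continuous_rescale_mul_inv hρ.continuous ε
  have hk := S.continuous_rescale hρ.continuous ε
  have hkc := hasCompactSupport_rescale (S := S) hρ hε
  have e1 : ∀ x, ENNReal.ofReal (S.mollifyMeasure ρ ε Ω γ x) =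
      ∫⁻ y, ENNReal.ofReal (S.rescale ρ ε (x * y⁻¹)) ∂γ := by
    intro x
    rw [mollifyMeasure, h.restrict_eq]
    refine ofReal_integral_eq_lintegral_ofReal ?_ (.of_forall fun y => hρ.rescale_nonneg hε _)
    simpa using S.integrable_kernel_mul hk hkc (integrable_const (1 : ℝ)) x
  have e2 : ∀ y, ∫⁻ x, ENNReal.ofReal (S.rescale ρ ε (x * y⁻¹)) = 1 := by
    intro y
    rw [← ofReal_integral_eq_lintegral_ofReal (hρ.integrable_rescale hε y)
      (.of_forall fun x => hρ.rescale_nonneg hε _), hρ.integral_rescale_mul_inv hε,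
      ENNReal.ofReal_one]
  calc ∫⁻ x in U, ENNReal.ofReal (S.mollifyMeasure ρ ε Ω γ x)
      ≤ ∫⁻ x, ENNReal.ofReal (S.mollifyMeasure ρ ε Ω γ x) := setLIntegral_le_lintegral _ _
    _ = ∫⁻ x, ∫⁻ y, ENNReal.ofReal (S.rescale ρ ε (x * y⁻¹)) ∂γ := by simp only [e1]
    _ = ∫⁻ y, (∫⁻ x, ENNReal.ofReal (S.rescale ρ ε (x * y⁻¹))) ∂γ :=
        lintegral_lintegral_swap (hcont.measurable.ennreal_ofReal.aemeasurable)
    _ = γ Set.univ := by simp only [e2, lintegral_one]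
    _ = γ Ω := by
        conv_lhs => rw [← h.restrict_eq]
        simp

/-- Mollified finite measures converge locally weakly. -/
theorem IsHomogeneousDist.tendsto_integral_mul_mollify (hd : S.IsHomogeneousDist d)
    (hρ : IsSymmMollifier d ρ) (hΩ : IsOpen Ω) [IsFiniteMeasure γ] {w : G → ℝ}
    (hw : Integrable w γ) {ψ : G → ℝ} (hψ : Continuous ψ) (hψc : HasCompactSupport ψ)
    (hψΩ : tsupport ψ ⊆ Ω) :
    Tendsto (fun ε : ℝ => ∫ x in rightInner d Ω (2 * ε),
      ψ x * ∫ y, S.rescale ρ ε (x * y⁻¹) * w y ∂γ) (𝓝[>] 0) (𝓝 (∫ y, ψ y * w y ∂γ)) := by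
  rw [Metric.tendsto_nhds]
  intro η' hη'
  set a := ∫ y, ‖w y‖ ∂γ with ha
  have ha0 : 0 ≤ a := integral_nonneg fun y => norm_nonneg _
  -- The `+ 1` covers the case a = 0 and makes the final bound ηa strictly smaller than η'.
  set η := η' / (a + 1) with hη
  have hηpos : 0 < η := by positivity
  have hηa : η * a < η' := by
    rw [hη, div_mul_eq_mul_div, div_lt_iff₀ (by positivity)]
    nlinarith
  obtain ⟨r, hr, hrψ⟩ := hd.exists_norm_sub_le hψ hψc hηpos
  obtain ⟨B, hB⟩ := hψc.exists_bound_of_continuous hψ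
  filter_upwards [hd.eventually_subset_rightInner hΩ hψc hψΩ, Ioo_mem_nhdsGT hr]
    with ε hsub hε
  have hε0 : 0 < ε := hε.1
  have hk := S.continuous_rescale hρ.continuous ε
  have hkc := hasCompactSupport_rescale (S := S) hρ hε0
  have hcont := S.continuous_rescale_mul_inv hρ.continuous ε
  obtain ⟨M, hM⟩ := hkc.exists_bound_of_continuous hk
  rw [setIntegral_eq_integral_of_forall_compl_eq_zero fun x hx => by
    rw [image_eq_zero_of_notMem_tsupport fun hx' => hx (hsub hx'), zero_mul]]
  have hψi : Integrable ψ := hψ.integrable_of_hasCompactSupport hψc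
  have hprod : Integrable (fun p : G × G => ψ p.1 * (S.rescale ρ ε (p.1 * p.2⁻¹) * w p.2))
      (volume.prod γ) := by
    refine ((hψi.norm.mul_prod hw.norm).const_mul M).mono' ?_ (.of_forall fun p => ?_)
    · exact (hψ.comp continuous_fst).aestronglyMeasurable.mul
        (hcont.aestronglyMeasurable.mul hw.aestronglyMeasurable.comp_snd)
    · rw [norm_mul, norm_mul]
      have := mul_le_mul_of_nonneg_right (hM (p.1 * p.2⁻¹))
        (mul_nonneg (norm_nonneg (ψ p.1)) (norm_nonneg (w p.2)))
      calc _ = ‖S.rescale ρ ε (p.1 * p.2⁻¹)‖ * (‖ψ p.1‖ * ‖w p.2‖) := by ring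
        _ ≤ _ := this
  -- Fubini replaces ψ by this average. Only points x = zy with d(z,0) < ε < r contribute, so A is
  -- within η of ψ.
  set A : G → ℝ := fun y => ∫ x, ψ x * S.rescale ρ ε (x * y⁻¹) with hA
  have hAw : ∀ y, ∫ x, ψ x * (S.rescale ρ ε (x * y⁻¹) * w y) = A y * w y := by
    intro y
    rw [hA, ← integral_mul_const]
    simp only [mul_assoc]
  have hfub : ∫ x, ψ x * ∫ y, S.rescale ρ ε (x * y⁻¹) * w y ∂γ = ∫ y, A y * w y ∂γ := by
    have h1 := integral_integral_swap
      (f := fun x y => ψ x * (S.rescale ρ ε (x * y⁻¹) * w y)) hprod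
    simp only [hAw] at h1
    rw [← h1]
    refine integral_congr_ae (.of_forall fun x => ?_)
    simp only [integral_const_mul]
  have hAi : Integrable (fun y => A y * w y) γ := by
    have := hprod.integral_prod_right
    simpa only [hAw] using this
  have hψw : Integrable (fun y => ψ y * w y) γ :=
    hw.bdd_mul hψ.aestronglyMeasurable (.of_forall hB)
  have hAψ : ∀ y, ‖A y - ψ y‖ ≤ η := by
    intro y
    have hκ := hρ.integrable_rescale (S := S) hε0 y
    have h1 : ψ y = ∫ x, ψ y * S.rescale ρ ε (x * y⁻¹) := by
      rw [integral_const_mul, hρ.integral_rescale_mul_inv hε0, mul_one]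
    have h2 : A y - ψ y = ∫ x, (ψ x - ψ y) * S.rescale ρ ε (x * y⁻¹) := by
      nth_rewrite 1 [h1]
      rw [hA, ← integral_sub (hκ.bdd_mul hψ.aestronglyMeasurable (.of_forall hB))
        (hκ.const_mul _)]
      simp only [sub_mul]
    rw [h2]
    refine (norm_integral_le_of_norm_le (hκ.const_mul η) (.of_forall fun x => ?_)).trans_eq ?_
    · rw [norm_mul, Real.norm_of_nonneg (hρ.rescale_nonneg hε0 _)]
      by_cases hx : x * y⁻¹ ∈ tsupport (S.rescale ρ ε)
      · refine mul_le_mul_of_nonneg_right ?_ (hρ.rescale_nonneg hε0 _)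
        have := hrψ (x * y⁻¹) ((hd.lt_of_mem_tsupport_rescale hρ hε0 hx).trans hε.2) y
        rwa [inv_mul_cancel_right] at this
      · rw [image_eq_zero_of_notMem_tsupport hx]
        simp
    · rw [integral_const_mul, hρ.integral_rescale_mul_inv hε0, mul_one]
  rw [hfub, dist_eq_norm, ← integral_sub hAi hψw]
  refine lt_of_le_of_lt (norm_integral_le_of_norm_le (hw.norm.const_mul η)
    (.of_forall fun y => ?_)) (by rwa [integral_const_mul])
  rw [← sub_mul, norm_mul]
  exact mul_le_mul_of_nonneg_right (hAψ y) (norm_nonneg _)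

theorem IsHorGradMeasure.tendsto_integral_inner [IsFiniteMeasure γ]
    (h : S.IsHorGradMeasure Ω f γ σ) (hd : S.IsHomogeneousDist d) (hρ : IsSymmMollifier d ρ)
    (hΩ : IsOpen Ω) {φ : G → S.Hor} (hφ : Continuous φ) (hφc : HasCompactSupport φ)
    (hφΩ : tsupport φ ⊆ Ω) :
    Tendsto (fun ε : ℝ => ∫ x in rightInner d Ω (2 * ε),
      inner ℝ (φ x) (S.mollifyVecMeasure ρ ε Ω γ σ x)) (𝓝[>] 0)
      (𝓝 (∫ x, inner ℝ (φ x) (σ x) ∂γ)) := by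
  have hφj : ∀ j : S.HorIdx, Continuous fun x => φ x j := fun j =>
    (EuclideanSpace.proj (𝕜 := ℝ) j).continuous.comp hφ
  have hφjc : ∀ j : S.HorIdx, HasCompactSupport fun x => φ x j := fun j =>
    IsCompact.of_isClosed_subset hφc (isClosed_tsupport _) (tsupport_component_subset φ j)
  have hinner : ∀ u v : S.Hor, inner ℝ u v = ∑ j, u j * v j := fun u v => by
    rw [PiLp.inner_apply]
    exact Finset.sum_congr rfl fun j _ => mul_comm _ _
  have hlim : ∫ x, inner ℝ (φ x) (σ x) ∂γ = ∑ j, ∫ x, φ x j * σ x j ∂γ := by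
    simp only [hinner]
    refine integral_finsetSum _ fun j _ => ?_
    obtain ⟨B, hB⟩ := (hφjc j).exists_bound_of_continuous (hφj j)
    exact (h.integrable_component j).bdd_mul (hφj j).aestronglyMeasurable (.of_forall hB)
  rw [hlim]
  refine (tendsto_finsetSum Finset.univ fun j _ => hd.tendsto_integral_mul_mollify hρ hΩ
    (h.integrable_component j) (hφj j) (hφjc j)
    ((tsupport_component_subset φ j).trans hφΩ)).congr' ?_
  filter_upwards [self_mem_nhdsWithin] with ε hε
  simp only [hinner, h.mollifyVecMeasure_apply]
  rw [integral_finsetSum]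
  intro j _
  have hc : Continuous fun x => φ x j * ∫ y, S.rescale ρ ε (x * y⁻¹) * σ y j ∂γ :=
    (hφj j).mul (S.continuous_integral_kernel_mul (S.continuous_rescale hρ.continuous ε)
      (hasCompactSupport_rescale hρ hε) (h.integrable_component j))
  exact (hc.integrable_of_hasCompactSupport (hφjc j).mul_right).integrableOn

theorem IsHorGradMeasure.tendsto_integral_mollifyMeasure [IsFiniteMeasure γ]
    (h : S.IsHorGradMeasure Ω f γ σ) (hd : S.IsHomogeneousDist d) (hρ : IsSymmMollifier d ρ)
    (hΩ : IsOpen Ω) {ψ : G → ℝ} (hψ : Continuous ψ) (hψc : HasCompactSupport ψ)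
    (hψΩ : tsupport ψ ⊆ Ω) :
    Tendsto (fun ε : ℝ => ∫ x in rightInner d Ω (2 * ε), ψ x * S.mollifyMeasure ρ ε Ω γ x)
      (𝓝[>] 0) (𝓝 (∫ x, ψ x ∂γ)) := by
  have := hd.tendsto_integral_mul_mollify hρ hΩ (integrable_const (μ := γ) (1 : ℝ)) hψ hψc hψΩ
  simpa only [h.mollifyMeasure_eq, mul_one] using this

/-- The total variations of the mollified gradients converge locally weakly to the variation. -/
theorem IsHorGradMeasure.tendsto_integral_mul_norm [IsFiniteMeasure γ]
    (h : S.IsHorGradMeasure Ω f γ σ) (hd : S.IsHomogeneousDist d) (hρ : IsSymmMollifier d ρ)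
    (hΩ : IsOpen Ω) {ψ : G → ℝ} (hψ : Continuous ψ) (hψc : HasCompactSupport ψ)
    (hψΩ : tsupport ψ ⊆ Ω) :
    Tendsto (fun ε : ℝ => ∫ x in rightInner d Ω (2 * ε),
      ψ x * ‖S.mollifyVecMeasure ρ ε Ω γ σ x‖) (𝓝[>] 0) (𝓝 (∫ x, ψ x ∂γ)) := by
  -- As ρ_ε * γ converges weakly to γ, it remains to show that the nonnegative defect tends weakly
  -- to zero.
  have hdiff : Tendsto (fun ε : ℝ => ∫ x in rightInner d Ω (2 * ε), ψ x *
      (S.mollifyMeasure ρ ε Ω γ x - ‖S.mollifyVecMeasure ρ ε Ω γ σ x‖)) (𝓝[>] 0) (𝓝 0) := by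
    rw [Metric.tendsto_nhds]
    intro η hη
    obtain ⟨B, hB⟩ := hψc.exists_bound_of_continuous hψ
    have hB0 : 0 ≤ B := (norm_nonneg _).trans (hB 0)
    obtain ⟨φ, -, hφσ, hφ, hφi⟩ := h.integrable.exists_hasCompactSupport_integral_sub_le
      (ε := η / (2 * B + 1)) (by positivity)
    -- The second factor is max(1, |φ|), a continuous bound for both 1 and |φ|; φ need not be
    -- truncated to the unit ball.
    set u : G → ℝ := fun x => |ψ x| * (1 + max (‖φ x‖ - 1) 0) with hu
    have huc : Continuous u :=
      hψ.abs.mul (continuous_const.add ((hφ.norm.sub continuous_const).max continuous_const))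
    have hus : tsupport u ⊆ tsupport ψ := closure_mono fun x hx h0 => hx (by simp [hu, h0])
    have huk : HasCompactSupport u :=
      IsCompact.of_isClosed_subset hψc (isClosed_tsupport _) hus
    set Φ : G → S.Hor := fun x => |ψ x| • φ x with hΦ
    have hΦc : Continuous Φ := hψ.abs.smul hφ
    have hΦs : tsupport Φ ⊆ tsupport ψ := closure_mono fun x hx h0 => hx (by simp [hΦ, h0])
    have hΦk : HasCompactSupport Φ :=
      IsCompact.of_isClosed_subset hψc (isClosed_tsupport _) hΦs
    have hJ := (h.tendsto_integral_mollifyMeasure hd hρ hΩ huc huk (hus.trans hψΩ)).sub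
      (h.tendsto_integral_inner hd hρ hΩ hΦc hΦk (hΦs.trans hψΩ))
    have hui : Integrable u γ := huc.integrable_of_hasCompactSupport huk
    have hΦi : Integrable (fun x => inner ℝ (Φ x) (σ x)) γ := by
      obtain ⟨B', hB'⟩ := hΦk.exists_bound_of_continuous hΦc
      refine (integrable_const B').mono'
        (hΦc.aestronglyMeasurable.inner h.aestronglyMeasurable) ?_
      filter_upwards [h.norm_eq_one] with x hx
      refine (norm_inner_le_norm _ _).trans ?_
      rw [hx, mul_one]
      exact hB' x
    have hlim : ∫ x, u x ∂γ - ∫ x, inner ℝ (Φ x) (σ x) ∂γ < η := by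
      rw [← integral_sub hui hΦi]
      have hle : ∫ x, (u x - inner ℝ (Φ x) (σ x)) ∂γ ≤ ∫ x, 2 * B * ‖σ x - φ x‖ ∂γ := by
        refine integral_mono_ae (hui.sub hΦi) ((h.integrable.sub hφi).norm.const_mul _) ?_
        filter_upwards [h.norm_eq_one] with x hx
        have e1 : 1 - inner ℝ (φ x) (σ x) ≤ ‖σ x - φ x‖ := by
          have : 1 - inner ℝ (φ x) (σ x) = inner ℝ (σ x - φ x) (σ x) := by
            rw [inner_sub_left, real_inner_self_eq_norm_sq, hx, one_pow]
          rw [this]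
          exact (real_inner_le_norm _ _).trans (by rw [hx, mul_one])
        have e2 : max (‖φ x‖ - 1) 0 ≤ ‖σ x - φ x‖ := by
          refine max_le ?_ (norm_nonneg _)
          have := norm_sub_norm_le (φ x) (σ x)
          rwa [hx, norm_sub_rev] at this
        simp only [hu, hΦ, real_inner_smul_left]
        have e3 : |ψ x| ≤ B := hB x
        calc |ψ x| * (1 + max (‖φ x‖ - 1) 0) - |ψ x| * inner ℝ (φ x) (σ x)
            = |ψ x| * (1 - inner ℝ (φ x) (σ x) + max (‖φ x‖ - 1) 0) := by ring
          _ ≤ |ψ x| * (2 * ‖σ x - φ x‖) :=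
              mul_le_mul_of_nonneg_left (by linarith) (abs_nonneg _)
          _ ≤ B * (2 * ‖σ x - φ x‖) := mul_le_mul_of_nonneg_right e3 (by positivity)
          _ = 2 * B * ‖σ x - φ x‖ := by ring
      refine hle.trans_lt ?_
      rw [integral_const_mul]
      calc 2 * B * ∫ x, ‖σ x - φ x‖ ∂γ ≤ 2 * B * (η / (2 * B + 1)) :=
            mul_le_mul_of_nonneg_left hφσ (by positivity)
        _ < η := by
            rw [mul_div_assoc', div_lt_iff₀ (by positivity)]
            nlinarith
    filter_upwards [hJ.eventually_lt_const hlim, self_mem_nhdsWithin] with ε hε hε0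
    have hac := h.continuous_mollifyMeasure hρ hε0
    have hmc := h.continuous_mollifyVecMeasure hρ hε0
    have hdn : ∀ x, 0 ≤ S.mollifyMeasure ρ ε Ω γ x - ‖S.mollifyVecMeasure ρ ε Ω γ σ x‖ := fun x =>
      sub_nonneg.2 (h.norm_mollifyVecMeasure_le hρ hε0 x)
    have hi1 : Integrable fun x => u x * S.mollifyMeasure ρ ε Ω γ x :=
      (huc.mul hac).integrable_of_hasCompactSupport huk.mul_right
    have hi2 : Integrable fun x => inner ℝ (Φ x) (S.mollifyVecMeasure ρ ε Ω γ σ x) := by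
      refine (hΦc.inner hmc).integrable_of_hasCompactSupport ?_
      refine IsCompact.of_isClosed_subset hψc (isClosed_tsupport _)
        (closure_mono fun x hx h0 => hx ?_)
      simp [hΦ, h0]
    rw [dist_zero_right]
    refine lt_of_le_of_lt ?_ hε
    rw [← integral_sub hi1.integrableOn hi2.integrableOn]
    refine norm_integral_le_of_norm_le (hi1.sub hi2).integrableOn (.of_forall fun x => ?_)
    rw [norm_mul, Real.norm_of_nonneg (hdn x), Real.norm_eq_abs]
    simp only [hu, hΦ, real_inner_smul_left]
    -- Write m and v for the mollified γ and σγ, and c = max(1, |φ|). Then m − |v| ≤ c(m − |v|) ≤ cm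
    -- − ⟨φ, v⟩, which is linear in (m, v) and so passes to the weak limit.
    have e1 : inner ℝ (φ x) (S.mollifyVecMeasure ρ ε Ω γ σ x) ≤
        ‖φ x‖ * ‖S.mollifyVecMeasure ρ ε Ω γ σ x‖ := real_inner_le_norm _ _
    have e2 : ‖φ x‖ ≤ 1 + max (‖φ x‖ - 1) 0 := by linarith [le_max_left (‖φ x‖ - 1) 0]
    have e3 := mul_le_mul_of_nonneg_right e2 (norm_nonneg (S.mollifyVecMeasure ρ ε Ω γ σ x))
    have e4 := mul_le_mul_of_nonneg_left (sub_nonneg.1 (hdn x)) (le_max_right (‖φ x‖ - 1) 0)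
    have e5 := mul_le_mul_of_nonneg_left (show
      S.mollifyMeasure ρ ε Ω γ x - ‖S.mollifyVecMeasure ρ ε Ω γ σ x‖ ≤
        (1 + max (‖φ x‖ - 1) 0) * S.mollifyMeasure ρ ε Ω γ x -
          inner ℝ (φ x) (S.mollifyVecMeasure ρ ε Ω γ σ x) by linarith) (abs_nonneg (ψ x))
    linarith
  have hmain := (h.tendsto_integral_mollifyMeasure hd hρ hΩ hψ hψc hψΩ).sub hdiff
  rw [sub_zero] at hmain
  refine hmain.congr' ?_
  filter_upwards [self_mem_nhdsWithin] with ε hε0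
  have hac := h.continuous_mollifyMeasure hρ hε0
  have hmc := h.continuous_mollifyVecMeasure hρ hε0
  rw [← integral_sub]
  · refine integral_congr_ae (.of_forall fun x => ?_)
    simp only
    ring
  · exact ((hψ.mul hac).integrable_of_hasCompactSupport hψc.mul_right).integrableOn
  · exact ((hψ.mul (hac.sub hmc.norm)).integrable_of_hasCompactSupport
      hψc.mul_right).integrableOn

end Convergence

end StratifiedGroup

end CarnotBV

end

/-! ### The main theorem -/

theorem mainTheorem7 {G : Type*} [NormedAddCommGroup G] [InnerProductSpace ℝ G]
    [FiniteDimensional ℝ G] [MeasurableSpace G] [BorelSpace G] [Group G]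
    (S : CarnotBV.StratifiedGroup G) (d : G → G → ℝ) (hd : S.IsHomogeneousDist d)
    (Ω : Set G) (hΩ : IsOpen Ω)
    (f : G → ℝ) (hf : S.IsBVHLoc Ω f) (hfΩ : S.hVariation f Ω < ⊤)
    (ρ : G → ℝ) (hρ : CarnotBV.StratifiedGroup.IsSymmMollifier d ρ) :
    -- the measure `D_H f = σ |D_H f|` exists, and
    (∃ (γ : Measure G) (σ : G → S.Hor), S.IsHorGradMeasure Ω f γ σ) ∧
    ∀ (γ : Measure G) (σ : G → S.Hor), S.IsHorGradMeasure Ω f γ σ →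
      -- `ρ_ε * f ∈ C¹_H` on the right inner part, with the bounds on the gradient
      (∀ ε : ℝ, 0 < ε →
        (CarnotBV.StratifiedGroup.rightInner d Ω (2 * ε)).Nonempty →
          S.IsC1H (CarnotBV.StratifiedGroup.rightInner d Ω (2 * ε)) (S.mollify ρ ε Ω f) ∧
          (volume.restrict (CarnotBV.StratifiedGroup.rightInner d Ω (2 * ε))).withDensity
              (fun x => ENNReal.ofReal ‖S.horGrad (S.mollify ρ ε Ω f) x‖) ≤
            (volume.restrict (CarnotBV.StratifiedGroup.rightInner d Ω (2 * ε))).withDensity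
              (fun x => ENNReal.ofReal (S.mollifyMeasure ρ ε Ω γ x)) ∧
          ∫⁻ x in CarnotBV.StratifiedGroup.rightInner d Ω (2 * ε),
              ENNReal.ofReal ‖S.horGrad (S.mollify ρ ε Ω f) x‖ ≤ γ Ω) ∧
      -- `∇_H (ρ_ε * f) ⇀ D_H f`
      (∀ φ : G → S.Hor, Continuous φ → HasCompactSupport φ → tsupport φ ⊆ Ω →
        Tendsto
          (fun ε : ℝ => ∫ x in CarnotBV.StratifiedGroup.rightInner d Ω (2 * ε),
            inner ℝ (φ x) (S.horGrad (S.mollify ρ ε Ω f) x))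
          (𝓝[>] 0) (𝓝 (∫ x in Ω, inner ℝ (φ x) (σ x) ∂γ))) ∧
      -- `|ρ_ε * D_H f| ⇀ |D_H f|`
      (∀ φ : G → ℝ, Continuous φ → HasCompactSupport φ → tsupport φ ⊆ Ω →
        Tendsto
          (fun ε : ℝ => ∫ x in CarnotBV.StratifiedGroup.rightInner d Ω (2 * ε),
            φ x * ‖S.mollifyVecMeasure ρ ε Ω γ σ x‖)
          (𝓝[>] 0) (𝓝 (∫ x in Ω, φ x ∂γ))) := by
  refine ⟨hf.exists_isHorGradMeasure hΩ hfΩ, fun γ σ h => ?_⟩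
  have hfin : IsFiniteMeasure γ := h.isFiniteMeasure hΩ hfΩ
  have hopen : ∀ {ε : ℝ}, 0 < ε →
      IsOpen (CarnotBV.StratifiedGroup.rightInner d Ω (2 * ε)) := fun hε =>
    hd.isOpen_rightInner Ω (by positivity)
  refine ⟨fun ε hε _ => ?_, fun φ hφ hφc hφΩ => ?_, fun φ hφ hφc hφΩ => ?_⟩
  · have hle : ∀ᵐ x ∂(volume.restrict (CarnotBV.StratifiedGroup.rightInner d Ω (2 * ε))),
        ENNReal.ofReal ‖S.horGrad (S.mollify ρ ε Ω f) x‖ ≤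
          ENNReal.ofReal (S.mollifyMeasure ρ ε Ω γ x) := by
      refine (ae_restrict_iff' (hopen hε).measurableSet).2 (.of_forall fun x hx => ?_)
      rw [h.horGrad_mollify hd hρ hf hΩ hε hx]
      exact ENNReal.ofReal_le_ofReal (h.norm_mollifyVecMeasure_le hρ hε x)
    exact ⟨h.isC1H_mollify hd hρ hf hΩ hε, withDensity_mono hle,
      (lintegral_mono_ae hle).trans (h.lintegral_mollifyMeasure_le hρ hε _)⟩
  · rw [h.restrict_eq]
    refine (h.tendsto_integral_inner hd hρ hΩ hφ hφc hφΩ).congr' ?_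
    filter_upwards [self_mem_nhdsWithin] with ε hε
    refine setIntegral_congr_fun (hopen hε).measurableSet fun x hx => ?_
    simp only [h.horGrad_mollify hd hρ hf hΩ hε hx]
  · rw [h.restrict_eq]
    exact h.tendsto_integral_mul_norm hd hρ hΩ hφ hφc hφΩ
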